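/- Let $\Gamma$ be the $3$-regular tree with distance $d_\Gamma$, and let $\Gamma_0$ be its edge graph (its vertices are the edges of $\Gamma$, two of them being adjacent when they are distinct and share an end point), with distance $d$ and Laplacian $-\Delta_{\Gamma_0}F(x)=\sum_{y\sim x}(F(x)-F(y))$. Let $\Sigma=[3-2\sqrt2,\,3+2\sqrt2]$, and for $\lambda\in\Sigma$ let $t=t(\lambda)\in[0,\pi/\log 2]$ be defined by $\lambda=3-2\sqrt2\cos(t\log2)$. Put $$c(z)=\frac13\,\frac{2^{1-z}-2^{z-1}}{2^{-z}-2^{z-1}},\qquad \varphi_z(n)=c(z)2^{-nz}+c(1-z)2^{-n(1-z)},$$ $$\tilde c(z)=(2+2^{-z}+2^{z})\,c(z),\qquad \psi_z(n)=\tilde c(z)2^{-nz}+\tilde c(1-z)2^{-n(1-z)}.$$ Let $m$ be the measure on $\Sigma$ that corresponds to $\frac{\log 2}{3\pi}\,|c(\tfrac12+it)|^{-2}\,dt$ on $[0,\pi/\log2]$ under $t\mapsto 3-2\sqrt2\cos(t\log2)$. For edges $x,y$ of $\Gamma$ and $\lambda$ in the interior of $\Sigma$ let $$\tilde P_\lambda(x,y)=\frac1{6-\lambda}\sum_{a\in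 x}\sum_{b\in y}\varphi_{\frac12+it}(d_\Gamma(a,b)),$$ where $a$, $b$ run over the end points of $x$, $y$. Let $\tilde P_6$ be the orthogonal projection of $\ell^2(\Gamma_0)$ onto its subspace of solutions of $-\Delta_{\Gamma_0}F=6F$. Then the following hold. (i) The measure $m$ is absolutely continuous: $$dm(\lambda)=\frac{3\sqrt{-\lambda^2+6\lambda-1}}{2\pi\lambda(6-\lambda)}\,d\lambda\quad\text{on }\Sigma .$$ (ii) The kernel is explicit: $\tilde P_\lambda(x,y)=\frac1{6-\lambda}\,\psi_{\frac12+it}(d(x,y))$ for all $x,y\in\Gamma_0$ and all $\lambda$ in the interior of $\Sigma$. (iii) For every $F\in\ell^2(\Gamma_0)$ and $x\in\Gamma_0$ one has $\tilde P_6F(x)=\sum_y\frac13\left(-\frac12\right)^{d(x,y)}F(y)$, and the series $$\tilde P_\lambda F(x)=\sum_{y}\tilde P_\lambda(x,y)F(y)=\frac{1}{6-\lambda}\sum_y\psi_{\frac12+it}(d(x,y))F(y)$$ converges unconditionally in $L^2(\Sigma,m)$ as a function of $\lambda$; for $m$-almost every $\lambda$ its sum agrees, for all $x$ at which the series converges absolutely,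 with the pointwise sum. Moreover $-\Delta_{\Gamma_0}\tilde P_\lambda F=\lambda\tilde P_\lambda F$ for $m$-almost every $\lambda$, and for every $x\in\Gamma_0$ the function $\lambda\mapsto\tilde P_\lambda F(x)$ is $m$-integrable with $$F(x)=\tilde P_6F(x)+\int_\Sigma\tilde P_\lambda F(x)\,dm(\lambda).$$ -/

import Mathlib

open MeasureTheory Filter Topology
open scoped ENNReal

noncomputable section

namespace TreeSpectral

/-! ### Graph Laplacian and its square summable eigenfunctions -/

/-- The space of complex square summable functions on `W`. -/
abbrev L2 (W : Type*) : Type _ := lp (fun _ : W => ℂ) 2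

/-- Minus the graph Laplacian, `(-Δ f)(x) = ∑_{y ~ x} (f x - f y)`, on all functions. -/
def negLaplacian {W : Type*} (H : SimpleGraph W) [H.LocallyFinite] : (W → ℂ) →ₗ[ℂ] (W → ℂ) where
  toFun f x := ∑ y ∈ H.neighborFinset x, (f x - f y)
  map_add' f g := by
    funext x
    simp only [Pi.add_apply, ← Finset.sum_add_distrib]
    exact Finset.sum_congr rfl fun y _ => by ring
  map_smul' c f := by
    funext x
    simp only [Pi.smul_apply, smul_eq_mul, RingHom.id_apply, Finset.mul_sum]
    exact Finset.sum_congr rfl fun y _ => by ring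

/-- The space of `ev`-eigenfunctions of `-Δ` in `ℓ²`. -/
def eigenspaceL2 {W : Type*} (H : SimpleGraph W) [H.LocallyFinite] (ev : ℂ) :
    Submodule ℂ (L2 W) where
  carrier := {F | negLaplacian H (F : W → ℂ) = ev • (F : W → ℂ)}
  add_mem' {F K} hF hK := by
    simp only [Set.mem_ofPred_eq] at *
    rw [lp.coeFn_add, map_add, hF, hK, smul_add]
  zero_mem' := by
    simp only [Set.mem_ofPred_eq, lp.coeFn_zero, map_zero, smul_zero]
  smul_mem' c F hF := by
    simp only [Set.mem_ofPred_eq] at *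
    rw [lp.coeFn_smul, map_smul, hF, smul_comm]

theorem continuous_lp_apply {W : Type*} (x : W) : Continuous fun F : L2 W => (F : W → ℂ) x :=
  (lp.evalCLM ℂ (fun _ : W => ℂ) 2 x).continuous

theorem isClosed_eigenspaceL2 {W : Type*} (H : SimpleGraph W) [H.LocallyFinite] (ev : ℂ) :
    IsClosed (eigenspaceL2 H ev : Set (L2 W)) := by
  have h : (eigenspaceL2 H ev : Set (L2 W)) =
      ⋂ x : W, {F : L2 W | ∑ y ∈ H.neighborFinset x, ((F : W → ℂ) x - (F : W → ℂ) y)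
        = ev * (F : W → ℂ) x} := by
    ext F
    simp only [Set.mem_iInter, Set.mem_ofPred_eq]
    exact funext_iff
  rw [h]
  refine isClosed_iInter fun x => isClosed_eq ?_ ?_
  · exact continuous_finsetSum _ fun y _ => (continuous_lp_apply x).sub (continuous_lp_apply y)
  · exact continuous_const.mul (continuous_lp_apply x)

instance hasOrthogonalProjection_eigenspaceL2 {W : Type*} (H : SimpleGraph W) [H.LocallyFinite]
    (ev : ℂ) : (eigenspaceL2 H ev).HasOrthogonalProjection :=
  haveI : CompleteSpace (eigenspaceL2 H ev) :=
    (isClosed_eigenspaceL2 H ev).isComplete.completeSpace_coe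
  inferInstance

/-! ### The edge graph -/

/-- Every edge of a locally finite graph meets only finitely many edges. -/
instance lineGraphLocallyFinite {V : Type*} (G : SimpleGraph V) [G.LocallyFinite] :
    G.lineGraph.LocallyFinite := fun e => by
  classical
  refine Set.Finite.fintype (s := G.lineGraph.neighborSet e) ?_
  have hfin : (⋃ v ∈ ((e : Sym2 V) : Set V), G.incidenceSet v).Finite := by
    refine Set.Finite.biUnion ?_ fun v _ => Set.toFinite _
    exact ((e : Sym2 V).toFinset.finite_toSet).subset fun v hv => by
      simpa using hv
  refine Set.Finite.of_finite_image (f := Subtype.val) (hfin.subset ?_)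
    Subtype.val_injective.injOn
  rintro _ ⟨f, hf, rfl⟩
  obtain ⟨v, hv, hv'⟩ := (show e ≠ f ∧ _ from hf).2
  exact Set.mem_biUnion hv ⟨f.2, hv'⟩

/-- The orthogonal projection of `ℓ²` of the edge graph onto the `6`-eigenspace. -/
def projSix {V : Type*} (G : SimpleGraph V) [G.LocallyFinite] :
    L2 G.edgeSet →L[ℂ] L2 G.edgeSet :=
  (eigenspaceL2 G.lineGraph 6).starProjection

/-! ### Spherical functions -/

/-- The coefficient `c(z) = (1/3) (2^{1-z} - 2^{z-1}) / (2^{-z} - 2^{z-1})`. -/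
def cFun (z : ℂ) : ℂ :=
  1 / 3 * (((2 : ℂ) ^ (1 - z) - (2 : ℂ) ^ (z - 1)) / ((2 : ℂ) ^ (-z) - (2 : ℂ) ^ (z - 1)))

/-- `φ_z(n) = c(z) 2^{-nz} + c(1-z) 2^{-n(1-z)}`. -/
def phi (z : ℂ) (n : ℕ) : ℂ :=
  cFun z * (2 : ℂ) ^ (-(n : ℂ) * z) + cFun (1 - z) * (2 : ℂ) ^ (-(n : ℂ) * (1 - z))

/-- `c̃(z) = (2 + 2^{-z} + 2^z) c(z)`. -/
def cTilde (z : ℂ) : ℂ := (2 + (2 : ℂ) ^ (-z) + (2 : ℂ) ^ z) * cFun z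

/-- `ψ_z(n) = c̃(z) 2^{-nz} + c̃(1-z) 2^{-n(1-z)}`. -/
def psi (z : ℂ) (n : ℕ) : ℂ :=
  cTilde z * (2 : ℂ) ^ (-(n : ℂ) * z) + cTilde (1 - z) * (2 : ℂ) ^ (-(n : ℂ) * (1 - z))

/-- The parameter `t` of the spectral value `lam`:
`lam = 3 - 2√2 cos (t log 2)` with `0 ≤ t ≤ π / log 2`. -/
def tOf (lam : ℝ) : ℝ := Real.arccos ((3 - lam) / (2 * √2)) / Real.log 2

/-- The point `1/2 + i t(lam)` of the critical line. -/
def critPoint (lam : ℝ) : ℂ := 1 / 2 + Complex.I * (tOf lam : ℂ)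

/-- The interval `Σ = [3 - 2√2, 3 + 2√2]`. -/
def specInterval : Set ℝ := Set.Icc (3 - 2 * √2) (3 + 2 * √2)

/-- The Plancherel measure `dm(t) = (log 2 / (3π)) |c(1/2 + it)|⁻² dt` on `[0, π / log 2]`. -/
def plancherelT : Measure ℝ :=
  (volume.restrict (Set.Icc 0 (Real.pi / Real.log 2))).withDensity fun t =>
    ENNReal.ofReal (Real.log 2 / (3 * Real.pi) *
      (‖cFun (1 / 2 + Complex.I * (t : ℂ))‖ ^ 2)⁻¹)

/-- The measure `m`: the Plancherel measure in the variable `lam = 3 - 2√2 cos (t log 2)`. -/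
def specMeasure : Measure ℝ :=
  plancherelT.map fun t => 3 - 2 * √2 * Real.cos (t * Real.log 2)

/-! ### The kernels on the edge graph -/

open Classical in
/-- `P̃_lam(x, y) = (6 - lam)⁻¹ ∑_{a ∈ x} ∑_{b ∈ y} P_lam(a, b)`, where
`P_lam(a, b) = φ_{1/2 + it}(d(a, b))`, `d` is the distance in `G`, and `a`, `b` run over the
end points of the edges `x`, `y`. -/
def edgeKernel {V : Type*} (G : SimpleGraph V) (lam : ℝ) (x y : G.edgeSet) : ℂ :=
  (6 - (lam : ℂ))⁻¹ * ∑ a ∈ (x : Sym2 V).toFinset, ∑ b ∈ (y : Sym2 V).toFinset,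
    phi (critPoint lam) (G.dist a b)

/-- `PF lam x = ∑_y P̃_lam(x, y) F y`. For a general square summable `F` the series does not
converge absolutely at a fixed `lam`; for each edge `x` it is summed unconditionally in
`L²(m)` as a function of `lam`. -/
def IsKernelTransform {V : Type*} (G : SimpleGraph V) (F : G.edgeSet → ℂ)
    (PF : ℝ → G.edgeSet → ℂ) : Prop :=
  ∀ x : G.edgeSet, MemLp (fun lam => PF lam x) 2 specMeasure ∧
    Tendsto (fun s : Finset G.edgeSet =>
        eLpNorm (fun lam => PF lam x - ∑ y ∈ s, edgeKernel G lam x y * F y) 2 specMeasure)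
      atTop (𝓝 0)

end TreeSpectral

end

open MeasureTheory Filter Topology
open scoped ENNReal

noncomputable section

namespace TreeSpectral

/-! ### Distances in trees -/

section Tree

variable {V : Type*} {G : SimpleGraph V}

/-! Root the tree at an edge. The edge graph is then distance-regular: every edge has four
neighbours, and an edge at distance `n + 1` has one neighbour at distance `n`, one at `n + 1` and
two at `n + 2` (`sum_neighborFinset_lineGraph_dist`). Radial eigenfunctions thus obey a three-term
recursion. Its solution with value 1 at the centre is `radialPoly`, and for `lam` in the interior of
the spectral interval the kernel is 2/3 of it at the distance (`edgeKernel_eq_radialPoly`).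

The analytic core is `integral_radialPoly_mul_radialPoly`: the polynomials are orthogonal for the
probability measure (2/3) m + (1/3) δ₆, with squared norms the reciprocals of the sphere sizes. The
term with `(-1 / 2) ^ (n + k)` is the contribution of the atom, since the `n`-th polynomial takes
the value (-1/2)^n at 6. After the substitution θ = t log 2 everything reduces to the Fourier
coefficients of 1 / (9 - 8 cos² θ).

Orthogonality gives the Gram matrix of the kernels based at one edge `x`. It yields a Bessel-type
bound (`norm_sum_kernelLp_sq_le`), hence unconditional convergence in L²(m). Its row against the
constant kernel at (x, x) gives the integral of the transform term by term: a Dirac mass minus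
(1/3)(-1/2)^d. That last kernel is the projection onto the 6-eigenspace (`hasSum_projSix`): it is
square summable because spheres grow like 2^n, it is a 6-eigenfunction, and Green's formula with an
explicit potential shows that it reproduces 6-eigenfunctions. The eigenfunction equation of the
components passes from the finite partial sums to the limit in L²(m). -/

theorem eq_of_dist_eq_dist_add_one (hG : G.IsTree) {r v u w : V} (hu : G.Adj v u) (hw : G.Adj v w)
    (hdu : G.dist r v = G.dist r u + 1) (hdw : G.dist r v = G.dist r w + 1) : u = w := by
  obtain ⟨p, hp⟩ := hG.connected.exists_walk_length_eq_dist r u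
  obtain ⟨q, hq⟩ := hG.connected.exists_walk_length_eq_dist r w
  have hp' : (p.concat hu.symm).IsPath :=
    SimpleGraph.Walk.isPath_of_length_eq_dist _ (by rw [SimpleGraph.Walk.length_concat]; omega)
  have hq' : (q.concat hw.symm).IsPath :=
    SimpleGraph.Walk.isPath_of_length_eq_dist _ (by rw [SimpleGraph.Walk.length_concat]; omega)
  have h := congrArg (fun P : G.Path r v => (P : G.Walk r v).penultimate)
    ((hG.isAcyclic.subsingleton_path r v).elim ⟨_, hp'⟩ ⟨_, hq'⟩)
  simpa using h

theorem exists_adj_dist_eq_add_one (hG : G.Connected) {r v : V} (hne : v ≠ r) :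
    ∃ u, G.Adj v u ∧ G.dist r v = G.dist r u + 1 := by
  obtain ⟨p, hp⟩ := hG.exists_walk_length_eq_dist v r
  cases p with
  | nil => exact absurd rfl hne
  | @cons _ u _ h q =>
    refine ⟨u, h, ?_⟩
    have h1 := SimpleGraph.dist_le q
    have h2 := h.diff_dist_adj (u := r)
    rw [SimpleGraph.Walk.length_cons] at hp
    rw [SimpleGraph.dist_comm] at hp
    rw [SimpleGraph.dist_comm] at h1
    omega

/-- Removing the edge `ab` splits the tree into two halves, and `ab` is the only edge that crosses
between them. -/
theorem eq_of_dist_cross (hG : G.IsTree) {a b p v : V} (hab : G.Adj a b) (hpv : G.Adj p v)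
    (hv : G.dist a v = G.dist b v + 1) (hp : G.dist b p = G.dist a p + 1) : p = a ∧ v = b := by
  have h1 := hG.dist_eq_dist_add_one_of_adj a hpv
  have h2 := hG.dist_eq_dist_add_one_of_adj b hpv
  by_cases hvb : v = b
  · subst hvb
    rw [SimpleGraph.dist_self] at hv h2
    refine ⟨((hG.connected.dist_eq_zero_iff).1 (by omega)).symm, rfl⟩
  · exfalso
    -- The neighbour `w` of `v` towards `b` and the vertex `p` are both one step nearer to `a` than
    -- `v`. Hence they coincide, although they lie in different halves.
    obtain ⟨w, hw, hdw⟩ := exists_adj_dist_eq_add_one hG.connected hvb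
    have h3 := hG.dist_eq_dist_add_one_of_adj a hw
    have h4 := hG.dist_eq_dist_add_one_of_adj w hab
    simp only [SimpleGraph.dist_comm (u := w)] at h4
    have := eq_of_dist_eq_dist_add_one hG (r := a) hw hpv.symm (by omega) (by omega)
    subst this
    omega

/-- The distance from `v` to the nearer one of `a`, `b`. -/
def pairDist (G : SimpleGraph V) (a b v : V) : ℕ := min (G.dist a v) (G.dist b v)

theorem pairDist_eq_zero_iff (hG : G.Connected) {a b v : V} :
    pairDist G a b v = 0 ↔ v = a ∨ v = b := by
  rw [pairDist, Nat.min_eq_zero_iff, hG.dist_eq_zero_iff, hG.dist_eq_zero_iff, eq_comm,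
    eq_comm (a := b)]

/-- Both distances change by exactly one along an edge, so their minimum could only stay constant if
the nearer end point switched; `eq_of_dist_cross` allows that on `ab` alone. -/
theorem pairDist_of_adj (hG : G.IsTree) {a b p v : V} (hab : G.Adj a b) (hpv : G.Adj p v)
    (hne : s(p, v) ≠ s(a, b)) :
    pairDist G a b v = pairDist G a b p + 1 ∨ pairDist G a b p = pairDist G a b v + 1 := by
  have h1 := hG.dist_eq_dist_add_one_of_adj a hpv
  have h2 := hG.dist_eq_dist_add_one_of_adj b hpv
  have h3 := hG.dist_eq_dist_add_one_of_adj p hab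
  have h4 := hG.dist_eq_dist_add_one_of_adj v hab
  simp only [SimpleGraph.dist_comm (u := p), SimpleGraph.dist_comm (u := v)] at h3 h4
  have h5 : ¬ (G.dist a v = G.dist b v + 1 ∧ G.dist b p = G.dist a p + 1) := fun h => by
    obtain ⟨rfl, rfl⟩ := eq_of_dist_cross hG hab hpv h.1 h.2
    exact hne rfl
  have h6 : ¬ (G.dist b v = G.dist a v + 1 ∧ G.dist a p = G.dist b p + 1) := fun h => by
    obtain ⟨rfl, rfl⟩ := eq_of_dist_cross hG hab.symm hpv h.1 h.2
    exact hne Sym2.eq_swap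
  unfold pairDist
  omega

/-- Parents in the tree rooted at the edge `ab`. At level 0 the parent is the other end point of
`ab`, on the same level; this is why the first bound is not strict. -/
theorem exists_parent (hG : G.IsTree) {a b : V} (hab : G.Adj a b) (v : V) :
    ∃ u₀, G.Adj v u₀ ∧ pairDist G a b u₀ ≤ pairDist G a b v ∧
      (pairDist G a b v ≠ 0 → pairDist G a b v = pairDist G a b u₀ + 1) ∧
      ∀ u, G.Adj v u → u ≠ u₀ → pairDist G a b u = pairDist G a b v + 1 := by
  have key : ∀ a b : V, G.Adj a b → G.dist a v < G.dist b v →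
      ∃ u₀, G.Adj v u₀ ∧ pairDist G a b u₀ ≤ pairDist G a b v ∧
      (pairDist G a b v ≠ 0 → pairDist G a b v = pairDist G a b u₀ + 1) ∧
      ∀ u, G.Adj v u → u ≠ u₀ → pairDist G a b u = pairDist G a b v + 1 := by
    intro a b hab hlt
    by_cases hva : v = a
    · subst hva
      have h0 : pairDist G v b v = 0 := (pairDist_eq_zero_iff hG.connected).2 (Or.inl rfl)
      refine ⟨b, hab, ?_, fun h => absurd h0 h, fun u hu hub => ?_⟩
      · rw [h0, (pairDist_eq_zero_iff hG.connected).2 (Or.inr rfl)]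
      · have h := pairDist_of_adj hG hab hu (by simp [hub, hab.ne])
        omega
    · obtain ⟨u₀, hu₀, hd⟩ := exists_adj_dist_eq_add_one hG.connected hva
      have hb := hG.dist_eq_dist_add_one_of_adj b hu₀
      have hp : pairDist G a b v = pairDist G a b u₀ + 1 := by
        unfold pairDist; omega
      refine ⟨u₀, hu₀, by omega, fun _ => hp, fun u hu hne => ?_⟩
      have hs : s(v, u) ≠ s(a, b) := fun h => by
        rcases Sym2.eq_iff.1 h with ⟨h1, -⟩ | ⟨h1, -⟩
        · exact hva h1
        · rw [h1, SimpleGraph.dist_self] at hlt; omega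
      refine (pairDist_of_adj hG hab hu hs).resolve_right fun h => hne ?_
      have h1 := hG.dist_eq_dist_add_one_of_adj a hu
      rcases h1 with h1 | h1
      · exact eq_of_dist_eq_dist_add_one hG hu hu₀ h1 hd
      · exfalso
        have h2 := hG.dist_eq_dist_add_one_of_adj u hab
        simp only [SimpleGraph.dist_comm (u := u)] at h2
        have h3 := hG.dist_eq_dist_add_one_of_adj v hab
        simp only [SimpleGraph.dist_comm (u := v)] at h3
        unfold pairDist at h
        exact hs (by
          obtain ⟨rfl, rfl⟩ := eq_of_dist_cross hG hab hu (by omega) (by omega)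
          rfl)
  have h4 := hG.dist_eq_dist_add_one_of_adj v hab
  simp only [SimpleGraph.dist_comm (u := v)] at h4
  rcases h4 with h4 | h4
  · simpa only [pairDist, min_comm] using key b a hab.symm (by omega)
  · exact key a b hab (by omega)

theorem sum_dist_add_dist (hG : G.IsTree) {a b : V} (hab : G.Adj a b) {R : Type*} [AddCommMonoid R]
    (f : ℕ → R) (v : V) :
    f (G.dist a v) + f (G.dist b v) = f (pairDist G a b v) + f (pairDist G a b v + 1) := by
  have h4 := hG.dist_eq_dist_add_one_of_adj v hab
  simp only [SimpleGraph.dist_comm (u := v)] at h4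
  unfold pairDist
  rcases h4 with h4 | h4
  · rw [h4, min_eq_right (by omega), add_comm]
  · rw [h4, min_eq_left (by omega)]

end Tree

/-! ### Distances in the edge graph -/

section LineGraph

/-- A walk lowers the level by at most one per step, and following parents lowers it by exactly one,
ending at the only vertex `x` without a parent. -/
theorem dist_eq_of_level {W : Type*} {H : SimpleGraph W} {x : W} {l : W → ℕ} (h0 : l x = 0)
    (hadj : ∀ y z, H.Adj y z → l y ≤ l z + 1)
    (hpar : ∀ y, y ≠ x → ∃ z, H.Adj y z ∧ l y = l z + 1) (y : W) :
    H.Reachable x y ∧ H.dist x y = l y := by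
  have low : ∀ y z (p : H.Walk y z), l y ≤ l z + p.length := by
    intro y z p
    induction p with
    | nil => simp
    | cons h q ih =>
      have := hadj _ _ h
      rw [SimpleGraph.Walk.length_cons]
      omega
  have up : ∀ n y, l y = n → ∃ p : H.Walk y x, p.length = n := by
    intro n
    induction n with
    | zero =>
      intro y hy
      by_cases hyx : y = x
      · subst hyx; exact ⟨.nil, rfl⟩
      · obtain ⟨z, -, hz⟩ := hpar y hyx
        omega
    | succ n ih =>
      intro y hy
      have hyx : y ≠ x := fun h => by rw [h] at hy; omega
      obtain ⟨z, hz, hl⟩ := hpar y hyx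
      obtain ⟨p, hp⟩ := ih z (by omega)
      exact ⟨.cons hz p, by rw [SimpleGraph.Walk.length_cons, hp]⟩
  obtain ⟨p, hp⟩ := up _ y rfl
  have hr : H.Reachable y x := ⟨p⟩
  refine ⟨hr.symm, ?_⟩
  obtain ⟨q, hq⟩ := hr.exists_walk_length_eq_dist
  have h1 := low _ _ q
  have h2 := SimpleGraph.dist_le p
  rw [SimpleGraph.dist_comm]
  omega

variable {V : Type*} {G : SimpleGraph V}

theorem lineGraph_dist_mk (hG : G.IsTree) {a b p v : V} (hab : G.Adj a b) (hpv : G.Adj p v) :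
    G.lineGraph.Reachable ⟨s(a, b), hab⟩ ⟨s(p, v), hpv⟩ ∧
      G.lineGraph.dist ⟨s(a, b), hab⟩ ⟨s(p, v), hpv⟩ =
        max (pairDist G a b p) (pairDist G a b v) := by
  set l : Sym2 V → ℕ := Sym2.lift ⟨fun p v => max (pairDist G a b p) (pairDist G a b v),
    fun _ _ => max_comm _ _⟩ with hl
  have hlm : ∀ p v, l s(p, v) = max (pairDist G a b p) (pairDist G a b v) := fun _ _ => rfl
  have ha : pairDist G a b a = 0 := (pairDist_eq_zero_iff hG.connected).2 (Or.inl rfl)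
  have hb : pairDist G a b b = 0 := (pairDist_eq_zero_iff hG.connected).2 (Or.inr rfl)
  have hloc : ∀ u w, G.Adj u w → l s(u, w) ≤ pairDist G a b u + 1 ∧
      pairDist G a b u ≤ l s(u, w) := by
    intro u w huw
    rw [hlm]
    by_cases h : s(u, w) = s(a, b)
    · rcases Sym2.eq_iff.1 h with ⟨rfl, rfl⟩ | ⟨rfl, rfl⟩ <;> omega
    · have := pairDist_of_adj hG hab huw h
      omega
  refine dist_eq_of_level (H := G.lineGraph) (l := fun e : G.edgeSet => l e) ?_ ?_ ?_
    ⟨s(p, v), hpv⟩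
  · simp only [hlm, ha, hb, max_self]
  · rintro ⟨e, he⟩ ⟨e', he'⟩ h
    obtain ⟨u, hu, hu'⟩ := (SimpleGraph.lineGraph_adj_iff_exists.1 h).2
    obtain ⟨w, rfl⟩ := hu
    obtain ⟨w', rfl⟩ := hu'
    have h1 := hloc u w he
    have h2 := hloc u w' he'
    show l s(u, w) ≤ l s(u, w') + 1
    omega
  · rintro ⟨e, he⟩ hne
    induction e with | _ u w
    have key : ∀ u w (he : G.Adj u w), s(u, w) ≠ s(a, b) →
        pairDist G a b u = pairDist G a b w + 1 →
        ∃ z : G.edgeSet, G.lineGraph.Adj ⟨s(u, w), he⟩ z ∧ l s(u, w) = l z + 1 := by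
      intro u w he hne hd
      obtain ⟨t, ht, h1, h2, h3⟩ := exists_parent hG hab w
      -- The preceding edge joins the nearer end `w` to its parent `t`. If `w` has level 0, this
      -- edge is `ab` itself.
      refine ⟨⟨s(w, t), ht⟩, SimpleGraph.lineGraph_adj_iff_exists.2 ⟨fun h => ?_, w, by simp,
        by simp⟩, ?_⟩
      · have : u = t := by
          rcases Sym2.eq_iff.1 (congrArg Subtype.val h) with ⟨h, -⟩ | ⟨h, -⟩
          · exact absurd h he.ne
          · exact h
        subst this
        omega
      · show l s(u, w) = l s(w, t) + 1
        rw [hlm, hlm]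
        omega
    have hne' : s(u, w) ≠ s(a, b) := fun h => hne (Subtype.ext h)
    rcases pairDist_of_adj hG hab he hne' with h | h
    · obtain ⟨z, hz, hz'⟩ := key w u (G.adj_symm he) (by rwa [Sym2.eq_swap]) h
      refine ⟨z, ?_, ?_⟩
      · rwa [show (⟨s(u, w), he⟩ : G.edgeSet) = ⟨s(w, u), G.adj_symm he⟩ from
          Subtype.ext Sym2.eq_swap]
      · show l s(u, w) = _
        rw [Sym2.eq_swap, hz']
    · exact key u w he hne' h

theorem lineGraph_connected (hG : G.IsTree) (x y : G.edgeSet) : G.lineGraph.Reachable x y := by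
  obtain ⟨x, hx⟩ := x
  obtain ⟨y, hy⟩ := y
  induction x with | _ a b
  induction y with | _ p v
  exact (lineGraph_dist_mk hG hx hy).1

theorem sum_lineGraph_neighborFinset [DecidableEq V] [G.LocallyFinite] {R : Type*} [AddCommMonoid R]
    (F : Sym2 V → R) {p v : V} (hpv : G.Adj p v) :
    ∑ z ∈ G.lineGraph.neighborFinset ⟨s(p, v), hpv⟩, F z =
      ∑ u ∈ (G.neighborFinset p).erase v, F s(p, u) +
        ∑ u ∈ (G.neighborFinset v).erase p, F s(v, u) := by
  have inj : ∀ w : V, Function.Injective fun u : V => s(w, u) := fun w u u' h =>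
    Sym2.congr_right.1 h
  have hdis : Disjoint (((G.neighborFinset p).erase v).image fun u => s(p, u))
      (((G.neighborFinset v).erase p).image fun u => s(v, u)) := by
    rw [Finset.disjoint_left]
    rintro e he he'
    simp only [Finset.mem_image, Finset.mem_erase, SimpleGraph.mem_neighborFinset] at he he'
    obtain ⟨u, ⟨h1, h2⟩, rfl⟩ := he
    obtain ⟨w, ⟨h3, h4⟩, h5⟩ := he'
    rcases Sym2.eq_iff.1 h5 with ⟨h, -⟩ | ⟨h, -⟩
    · exact hpv.ne h.symm
    · exact h1 h.symm
  have himg : (G.lineGraph.neighborFinset ⟨s(p, v), hpv⟩).image Subtype.val =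
      (((G.neighborFinset p).erase v).image fun u => s(p, u)) ∪
      (((G.neighborFinset v).erase p).image fun u => s(v, u)) := by
    ext e
    simp only [Finset.mem_image, Finset.mem_union, Finset.mem_erase,
      SimpleGraph.mem_neighborFinset, SimpleGraph.lineGraph_adj_iff_exists]
    constructor
    · rintro ⟨⟨e, he⟩, ⟨hne, u, hu, hu'⟩, rfl⟩
      obtain ⟨w, rfl⟩ := hu'
      have hne' : s(p, v) ≠ s(u, w) := fun h => hne (Subtype.ext h)
      rcases Sym2.mem_iff.1 hu with rfl | rfl
      · exact Or.inl ⟨w, ⟨fun h => hne' (by rw [h]), he⟩, rfl⟩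
      · exact Or.inr ⟨w, ⟨fun h => hne' (by rw [h, Sym2.eq_swap]), he⟩, rfl⟩
    · rintro (⟨u, ⟨h1, h2⟩, rfl⟩ | ⟨u, ⟨h1, h2⟩, rfl⟩)
      · refine ⟨⟨s(p, u), h2⟩, ⟨fun h => h1 ?_, p, by simp, by simp⟩, rfl⟩
        exact (inj p (congrArg Subtype.val h)).symm
      · refine ⟨⟨s(v, u), h2⟩, ⟨fun h => h1 ?_, v, by simp, by simp⟩, rfl⟩
        exact (inj v (Sym2.eq_swap.trans (congrArg Subtype.val h))).symm
  rw [← Finset.sum_image (f := F) (g := Subtype.val) Subtype.val_injective.injOn, himg,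
    Finset.sum_union hdis, Finset.sum_image (inj p).injOn, Finset.sum_image (inj v).injOn]

theorem sum_neighborFinset_pairDist [G.LocallyFinite] (hG : G.IsTree)
    (h3 : G.IsRegularOfDegree 3) {a b : V} (hab : G.Adj a b) {R : Type*} [CommRing R] (f : ℕ → R)
    (v : V) : ∑ u ∈ G.neighborFinset v, f (max (pairDist G a b v) (pairDist G a b u)) =
      f (pairDist G a b v) + 2 * f (pairDist G a b v + 1) := by
  classical
  obtain ⟨u₀, h0, h1, -, h2⟩ := exists_parent hG hab v
  have hmem : u₀ ∈ G.neighborFinset v := by simpa using h0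
  rw [← Finset.add_sum_erase _ _ hmem, max_eq_left h1]
  congr 1
  have hc : ((G.neighborFinset v).erase u₀).card = 2 := by
    rw [Finset.card_erase_of_mem hmem, G.card_neighborFinset_eq_degree, h3 v]
  rw [Finset.sum_congr rfl (g := fun _ => f (pairDist G a b v + 1)), Finset.sum_const, hc]
  · simp
  · intro u hu
    rw [Finset.mem_erase, SimpleGraph.mem_neighborFinset] at hu
    rw [h2 u hu.2 hu.1, max_eq_right (Nat.le_succ _)]

/-- The intersection numbers, on which every radial computation rests. Sum over the stars of the two
end points and subtract the edge itself, which lies in both; away from the centre the end points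
have consecutive levels. -/
theorem sum_neighborFinset_lineGraph_dist [G.LocallyFinite] (hG : G.IsTree)
    (h3 : G.IsRegularOfDegree 3) {R : Type*} [CommRing R] (f : ℕ → R)
    (x y : G.edgeSet) :
    (G.lineGraph.dist x y = 0 →
      ∑ z ∈ G.lineGraph.neighborFinset y, f (G.lineGraph.dist x z) = 4 * f 1) ∧
    ∀ n, G.lineGraph.dist x y = n + 1 →
      ∑ z ∈ G.lineGraph.neighborFinset y, f (G.lineGraph.dist x z) =
        f n + f (n + 1) + 2 * f (n + 2) := by
  classical
  obtain ⟨x, hab⟩ := x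
  obtain ⟨y, hpv⟩ := y
  induction x with | _ a b
  induction y with | _ p v
  set l : Sym2 V → ℕ := Sym2.lift ⟨fun p v => max (pairDist G a b p) (pairDist G a b v),
    fun _ _ => max_comm _ _⟩ with hl
  have hlm : ∀ p v, l s(p, v) = max (pairDist G a b p) (pairDist G a b v) := fun _ _ => rfl
  have hd : ∀ z : G.edgeSet, G.lineGraph.dist ⟨s(a, b), hab⟩ z = l z := by
    rintro ⟨z, hz⟩
    induction z with | _ u w
    exact (lineGraph_dist_mk hG hab hz).2
  have hv : v ∈ G.neighborFinset p := by simpa using hpv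
  have hp : p ∈ G.neighborFinset v := by simpa using G.adj_symm hpv
  have hsum : ∑ z ∈ G.lineGraph.neighborFinset ⟨s(p, v), hpv⟩,
      f (G.lineGraph.dist ⟨s(a, b), hab⟩ z) =
      f (pairDist G a b p) + 2 * f (pairDist G a b p + 1) +
      (f (pairDist G a b v) + 2 * f (pairDist G a b v + 1)) - 2 * f (l s(p, v)) := by
    simp only [hd]
    rw [sum_lineGraph_neighborFinset (fun e => f (l e)) hpv, Finset.sum_erase_eq_sub hv,
      Finset.sum_erase_eq_sub hp]
    have e1 := sum_neighborFinset_pairDist hG h3 hab f p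
    have e2 := sum_neighborFinset_pairDist hG h3 hab f v
    simp only [hlm]
    rw [e1, e2, max_comm (pairDist G a b v)]
    ring
  rw [hsum, hd]
  show (l s(p, v) = 0 → _) ∧ ∀ n, l s(p, v) = n + 1 → _
  have h0 := pairDist_eq_zero_iff hG.connected (a := a) (b := b) (v := p)
  have h0' := pairDist_eq_zero_iff hG.connected (a := a) (b := b) (v := v)
  constructor
  · intro h
    rw [h]
    rw [hlm] at h
    have e1 : pairDist G a b p = 0 := by omega
    have e2 : pairDist G a b v = 0 := by omega
    rw [e1, e2]
    ring
  · intro n h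
    have hne : s(p, v) ≠ s(a, b) := by
      intro hs
      have ha : pairDist G a b a = 0 := (pairDist_eq_zero_iff hG.connected).2 (Or.inl rfl)
      have hb : pairDist G a b b = 0 := (pairDist_eq_zero_iff hG.connected).2 (Or.inr rfl)
      rw [hs, hlm] at h
      omega
    rw [h]
    rw [hlm] at h
    rcases pairDist_of_adj (a := a) (b := b) (p := p) (v := v) hG hab hpv hne with e | e
    · have e1 : pairDist G a b v = n + 1 := by omega
      have e2 : pairDist G a b p = n := by omega
      rw [e1, e2]; ring
    · have e1 : pairDist G a b p = n + 1 := by omega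
      have e2 : pairDist G a b v = n := by omega
      rw [e1, e2]; ring

open Classical in
theorem sum_endpoints_dist (hG : G.IsTree) {R : Type*} [CommRing R] (f : ℕ → R)
    (x y : G.edgeSet) :
    (G.lineGraph.dist x y = 0 →
      ∑ a ∈ (x : Sym2 V).toFinset, ∑ b ∈ (y : Sym2 V).toFinset, f (G.dist a b) =
        2 * f 0 + 2 * f 1) ∧
    ∀ n, G.lineGraph.dist x y = n + 1 →
      ∑ a ∈ (x : Sym2 V).toFinset, ∑ b ∈ (y : Sym2 V).toFinset, f (G.dist a b) =
        f n + 2 * f (n + 1) + f (n + 2) := by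
  obtain ⟨x, hab⟩ := x
  obtain ⟨y, hpv⟩ := y
  induction x with | _ a b
  induction y with | _ p v
  have e1 : ∀ u w : V, G.Adj u w → ∀ g : V → R, ∑ t ∈ s(u, w).toFinset, g t = g u + g w := by
    intro u w h g
    rw [Sym2.toFinset_mk_eq, Finset.sum_pair h.ne]
  have hsum : ∑ a ∈ s(a, b).toFinset, ∑ b ∈ s(p, v).toFinset, f (G.dist a b) =
      f (pairDist G a b p) + f (pairDist G a b p + 1) +
      (f (pairDist G a b v) + f (pairDist G a b v + 1)) := by
    rw [e1 a b hab, e1 p v hpv, e1 p v hpv, ← sum_dist_add_dist hG hab, ← sum_dist_add_dist hG hab]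
    ring
  simp only [hsum, (lineGraph_dist_mk hG hab hpv).2]
  constructor
  · intro h
    have e1 : pairDist G a b p = 0 := by omega
    have e2 : pairDist G a b v = 0 := by omega
    rw [e1, e2]
    ring
  · intro n h
    have hne : s(p, v) ≠ s(a, b) := by
      intro hs
      have ha : pairDist G a b a = 0 := (pairDist_eq_zero_iff hG.connected).2 (Or.inl rfl)
      have hb : pairDist G a b b = 0 := (pairDist_eq_zero_iff hG.connected).2 (Or.inr rfl)
      rcases Sym2.eq_iff.1 hs with ⟨rfl, rfl⟩ | ⟨rfl, rfl⟩ <;> omega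
    rcases pairDist_of_adj (a := a) (b := b) (p := p) (v := v) hG hab hpv hne with e | e
    · have e1 : pairDist G a b v = n + 1 := by omega
      have e2 : pairDist G a b p = n := by omega
      rw [e1, e2]; ring
    · have e1 : pairDist G a b p = n + 1 := by omega
      have e2 : pairDist G a b v = n := by omega
      rw [e1, e2]; ring

/-- The number of edges at distance `n` from a given edge of the `3`-regular tree. -/
def sphereSize : ℕ → ℕ
  | 0 => 1
  | n + 1 => 4 * 2 ^ n

theorem exists_sphere [G.LocallyFinite] (hG : G.IsTree) (h3 : G.IsRegularOfDegree 3)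
    (x : G.edgeSet) (n : ℕ) :
    ∃ S : Finset G.edgeSet, (∀ y, y ∈ S ↔ G.lineGraph.dist x y = n) ∧ S.card ≤ sphereSize n := by
  classical
  induction n with
  | zero =>
    refine ⟨{x}, fun y => ?_, by simp [sphereSize]⟩
    rw [Finset.mem_singleton, (lineGraph_connected hG x y).dist_eq_zero_iff, eq_comm]
  | succ n ih =>
    obtain ⟨S, hS, hc⟩ := ih
    refine ⟨S.biUnion fun y => (G.lineGraph.neighborFinset y).filter
      fun z => G.lineGraph.dist x z = n + 1, fun z => ?_, ?_⟩
    · simp only [Finset.mem_biUnion, Finset.mem_filter, SimpleGraph.mem_neighborFinset]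
      refine ⟨fun ⟨_, _, _, h⟩ => h, fun h => ?_⟩
      obtain ⟨p, hp⟩ := (lineGraph_connected hG z x).exists_walk_length_eq_dist
      cases p with
      | nil => rw [SimpleGraph.dist_self] at h; omega
      | @cons _ y _ hzy q =>
        refine ⟨y, (hS y).2 ?_, hzy.symm, h⟩
        have h1 := SimpleGraph.dist_le q
        have h2 := hzy.diff_dist_adj (u := x)
        rw [SimpleGraph.Walk.length_cons, SimpleGraph.dist_comm] at hp
        rw [SimpleGraph.dist_comm] at h1
        omega
    · have hdeg : ∀ y ∈ S, ((G.lineGraph.neighborFinset y).filter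
          fun z => G.lineGraph.dist x z = n + 1).card ≤ if n = 0 then 4 else 2 := by
        intro y hy
        -- Applied to the indicator of `n + 1`, the intersection numbers count the neighbours in the
        -- next sphere.
        have h := sum_neighborFinset_lineGraph_dist hG h3
          (fun k => if k = n + 1 then (1 : ℤ) else 0) x y
        rw [(hS y).1 hy] at h
        rw [Finset.card_filter, ← Nat.cast_le (α := ℤ), Nat.cast_sum]
        simp only [Nat.cast_ite, Nat.cast_one, Nat.cast_zero]
        cases n with
        | zero => rw [h.1 rfl]; simp
        | succ n => rw [h.2 n rfl]; simp [show n ≠ n + 1 + 1 by omega]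
      refine (Finset.card_biUnion_le_card_mul _ _ _ hdeg).trans ?_
      refine (Nat.mul_le_mul_right _ hc).trans ?_
      cases n with
      | zero => simp [sphereSize]
      | succ n => simp [sphereSize]; ring_nf; rfl

theorem countable_edgeSet [G.LocallyFinite] (hG : G.IsTree) (h3 : G.IsRegularOfDegree 3) :
    Countable G.edgeSet := by
  rcases isEmpty_or_nonempty G.edgeSet with h | ⟨⟨x⟩⟩
  · infer_instance
  · choose S hS _ using exists_sphere hG h3 x
    refine Set.countable_univ_iff.1 ((Set.countable_iUnion fun n =>
      (S n).countable_toSet).mono fun y _ => ?_)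
    exact Set.mem_iUnion.2 ⟨_, (hS _ y).2 rfl⟩

end LineGraph

/-! ### The spherical functions and the kernel -/

section Kernel

theorem two_cpow_one_sub (z : ℂ) : (2 : ℂ) ^ (1 - z) = 2 * (2 : ℂ) ^ (-z) := by
  rw [sub_eq_add_neg, Complex.cpow_add _ _ two_ne_zero, Complex.cpow_one]

theorem two_cpow_eq (z : ℂ) : (2 : ℂ) ^ z = 2 * (2 : ℂ) ^ (z - 1) := by
  rw [Complex.cpow_sub _ _ two_ne_zero, Complex.cpow_one]
  ring

/-- With a = 2^(-z) and b = 2^(z-1), the other powers are 2a and 2b and the only relation needed is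
ab = 1/2. Identities between spherical functions become algebra in a and b. -/
theorem two_cpow_mul_two_cpow (z : ℂ) : (2 : ℂ) ^ (-z) * (2 : ℂ) ^ (z - 1) = 1 / 2 := by
  rw [← Complex.cpow_add _ _ two_ne_zero, show -z + (z - 1) = -1 by ring, Complex.cpow_neg_one]
  norm_num

theorem cFun_eq (z : ℂ) : cFun z = 1 / 3 * ((2 * (2 : ℂ) ^ (-z) - (2 : ℂ) ^ (z - 1)) /
    ((2 : ℂ) ^ (-z) - (2 : ℂ) ^ (z - 1))) := by
  rw [cFun, two_cpow_one_sub]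

theorem cFun_one_sub (z : ℂ) : cFun (1 - z) =
    1 / 3 * ((2 * (2 : ℂ) ^ (z - 1) - (2 : ℂ) ^ (-z)) /
    ((2 : ℂ) ^ (z - 1) - (2 : ℂ) ^ (-z))) := by
  rw [cFun_eq, neg_sub, show 1 - z - 1 = -z by ring]

theorem phi_eq (z : ℂ) (n : ℕ) :
    phi z n = cFun z * ((2 : ℂ) ^ (-z)) ^ n + cFun (1 - z) * ((2 : ℂ) ^ (z - 1)) ^ n := by
  rw [phi, ← Complex.cpow_nat_mul, ← Complex.cpow_nat_mul]
  congr 3 <;> ring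

theorem psi_eq (z : ℂ) (n : ℕ) :
    psi z n = (2 + (2 : ℂ) ^ (-z) + 2 * (2 : ℂ) ^ (z - 1)) * cFun z * ((2 : ℂ) ^ (-z)) ^ n +
      (2 + (2 : ℂ) ^ (z - 1) + 2 * (2 : ℂ) ^ (-z)) * cFun (1 - z) * ((2 : ℂ) ^ (z - 1)) ^ n := by
  rw [psi, cTilde, cTilde, neg_sub, two_cpow_one_sub, two_cpow_eq z, ← Complex.cpow_nat_mul,
    ← Complex.cpow_nat_mul]
  congr 3 <;> ring

/-- This holds for each exponential separately, whatever its coefficient: 1 + 2a + a² = a (2 + a +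
2b). At distance 0 the actual values of `cFun` are needed. -/
theorem phi_sum_eq_psi_succ (z : ℂ) (n : ℕ) :
    phi z n + 2 * phi z (n + 1) + phi z (n + 2) = psi z (n + 1) := by
  have h := two_cpow_mul_two_cpow z
  simp only [phi_eq, psi_eq, pow_succ]
  linear_combination (-2 * cFun z * ((2 : ℂ) ^ (-z)) ^ n -
    2 * cFun (1 - z) * ((2 : ℂ) ^ (z - 1)) ^ n) * h

theorem phi_sum_eq_psi_zero (z : ℂ) : 2 * phi z 0 + 2 * phi z 1 = psi z 0 := by
  have h := two_cpow_mul_two_cpow z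
  simp only [phi_eq, psi_eq, cFun_eq z, cFun_one_sub]
  set a := (2 : ℂ) ^ (-z)
  set b := (2 : ℂ) ^ (z - 1)
  -- If the denominators of both coefficients vanish, division by zero makes the coefficients zero
  -- and both sides vanish.
  by_cases hab : a = b
  · simp [hab]
  · have h1 : a - b ≠ 0 := sub_ne_zero.2 hab
    have h2 : b - a ≠ 0 := sub_ne_zero.2 (Ne.symm hab)
    rw [show b - a = -(a - b) by ring]
    field_simp
    ring

theorem edgeKernel_eq_psi {V : Type*} {G : SimpleGraph V} (hG : G.IsTree) (lam : ℝ)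
    (x y : G.edgeSet) :
    edgeKernel G lam x y = (6 - (lam : ℂ))⁻¹ * psi (critPoint lam) (G.lineGraph.dist x y) := by
  rw [edgeKernel]
  congr 1
  have h := sum_endpoints_dist hG (phi (critPoint lam)) x y
  cases hd : G.lineGraph.dist x y with
  | zero => rw [h.1 hd, phi_sum_eq_psi_zero]
  | succ n => rw [h.2 n hd, phi_sum_eq_psi_succ]

theorem two_cpow_neg_crit (t : ℝ) : (2 : ℂ) ^ (-(1 / 2 + Complex.I * (t : ℂ))) =
    ((√2 : ℝ) : ℂ)⁻¹ * ((Real.cos (t * Real.log 2) : ℂ) -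
      (Real.sin (t * Real.log 2) : ℂ) * Complex.I) := by
  have h2 : ((√2 : ℝ) : ℂ)⁻¹ = Complex.exp (-((Real.log 2 / 2 : ℝ) : ℂ)) := by
    rw [Complex.exp_neg, ← Complex.ofReal_exp, Real.exp_half, Real.exp_log two_pos]
  rw [Complex.cpow_def_of_ne_zero two_ne_zero, h2,
    show (Complex.log 2) = ((Real.log 2 : ℝ) : ℂ) by rw [Complex.ofReal_log zero_le_two]; simp]
  have h3 : (Real.cos (t * Real.log 2) : ℂ) - (Real.sin (t * Real.log 2) : ℂ) * Complex.I =
      Complex.exp (((-(t * Real.log 2) : ℝ) : ℂ) * Complex.I) := by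
    rw [Complex.exp_mul_I, ← Complex.ofReal_cos, ← Complex.ofReal_sin, Real.cos_neg, Real.sin_neg]
    push_cast
    ring
  rw [h3, ← Complex.exp_add]
  congr 1
  push_cast
  ring

theorem two_cpow_crit_sub_one (t : ℝ) : (2 : ℂ) ^ (1 / 2 + Complex.I * (t : ℂ) - 1) =
    ((√2 : ℝ) : ℂ)⁻¹ * ((Real.cos (t * Real.log 2) : ℂ) +
      (Real.sin (t * Real.log 2) : ℂ) * Complex.I) := by
  have h := two_cpow_neg_crit (-t)
  rw [neg_mul, Real.cos_neg, Real.sin_neg] at h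
  rw [show (1 / 2 + Complex.I * (t : ℂ) - 1) = -(1 / 2 + Complex.I * ((-t : ℝ) : ℂ)) by
    push_cast; ring, h]
  push_cast
  ring

theorem ofReal_sqrt_two_sq : ((√2 : ℝ) : ℂ) ^ 2 = 2 := by
  rw [← Complex.ofReal_pow, Real.sq_sqrt zero_le_two]
  norm_num

theorem ofReal_sqrt_two_ne_zero : ((√2 : ℝ) : ℂ) ≠ 0 := by
  simp

theorem cFun_crit (t : ℝ) : cFun (1 / 2 + Complex.I * (t : ℂ)) =
    1 / 3 * (((Real.cos (t * Real.log 2) : ℂ) - 3 * (Real.sin (t * Real.log 2) : ℂ) * Complex.I) /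
      (-2 * (Real.sin (t * Real.log 2) : ℂ) * Complex.I)) := by
  rw [cFun_eq, two_cpow_neg_crit, two_cpow_crit_sub_one]
  congr 1
  rw [← mul_div_mul_left _ (-2 * (Real.sin (t * Real.log 2) : ℂ) * Complex.I)
    (inv_ne_zero ofReal_sqrt_two_ne_zero)]
  congr 1 <;> ring

/-- Where the sine vanishes, `cFun` has a pole and gets the default value 0; both sides are then 0,
which is also the limiting value, so no point has to be excluded. -/
theorem inv_norm_cFun_sq (t : ℝ) : (‖cFun (1 / 2 + Complex.I * (t : ℂ))‖ ^ 2)⁻¹ =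
    36 * Real.sin (t * Real.log 2) ^ 2 / (9 - 8 * Real.cos (t * Real.log 2) ^ 2) := by
  rw [cFun_crit, ← Complex.normSq_eq_norm_sq]
  set c := Real.cos (t * Real.log 2)
  set s := Real.sin (t * Real.log 2)
  have hcs : c ^ 2 + s ^ 2 = 1 := Real.cos_sq_add_sin_sq _
  have e1 : Complex.normSq ((c : ℂ) - 3 * (s : ℂ) * Complex.I) = 9 - 8 * c ^ 2 := by
    simp [Complex.normSq_apply]
    linear_combination 9 * hcs
  have e2 : Complex.normSq (-2 * (s : ℂ) * Complex.I) = 4 * s ^ 2 := by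
    simp [Complex.normSq_apply]
    ring
  have e3 : Complex.normSq (1 / 3) = 1 / 9 := by
    rw [map_div₀]; norm_num [Complex.normSq_ofNat]
  rw [map_mul, e3, map_div₀, e1, e2, mul_inv, inv_div, inv_div]
  ring

/-- The polynomials with `-Δ (p_{d(x, ·)}) = lam p_{d(x, ·)}` on the edge graph and `p_0 = 1`. -/
def radialPoly : ℕ → ℝ → ℝ
  | 0, _ => 1
  | 1, lam => 1 - lam / 4
  | n + 2, lam => ((3 - lam) * radialPoly (n + 1) lam - radialPoly n lam) / 2

theorem interior_specInterval :
    interior specInterval = Set.Ioo (3 - 2 * √2) (3 + 2 * √2) := interior_Icc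

theorem mem_Ioo_of_mem_interior {lam : ℝ} (h : lam ∈ interior specInterval) :
    (3 - lam) / (2 * √2) ∈ Set.Ioo (-1 : ℝ) 1 := by
  rw [interior_specInterval] at h
  have h2 : (0 : ℝ) < 2 * √2 := by positivity
  constructor
  · rw [lt_div_iff₀ h2]; linarith [h.2]
  · rw [div_lt_iff₀ h2]; linarith [h.1]

theorem two_mul_sqrt_two_lt : 2 * √2 < 3 := by
  have h : √2 < 3 / 2 := by
    rw [Real.sqrt_lt' (by norm_num)]; norm_num
  linarith

/-- Both sides satisfy the recursion with a + b = (3 - lam)/2 and ab = 1/2, so only `n = 0` and `n =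
1` need checking. In the interior the sine is nonzero, so a ≠ b and the coefficients are genuine
quotients. -/
theorem psi_crit {lam : ℝ} (hl : lam ∈ interior specInterval) (n : ℕ) :
    psi (critPoint lam) n = (6 - (lam : ℂ)) * ((2 / 3 * radialPoly n lam : ℝ) : ℂ) := by
  have hm := mem_Ioo_of_mem_interior hl
  have hlog : Real.log 2 ≠ 0 := (Real.log_pos one_lt_two).ne'
  have hθ : tOf lam * Real.log 2 = Real.arccos ((3 - lam) / (2 * √2)) := by
    rw [tOf, div_mul_cancel₀ _ hlog]
  have hcos : Real.cos (tOf lam * Real.log 2) = (3 - lam) / (2 * √2) := by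
    rw [hθ, Real.cos_arccos hm.1.le hm.2.le]
  have hsin : Real.sin (tOf lam * Real.log 2) ≠ 0 := by
    rw [hθ]
    refine (Real.sin_pos_of_pos_of_lt_pi (Real.arccos_pos.2 hm.2) ?_).ne'
    exact lt_of_le_of_ne (Real.arccos_le_pi _) fun h => by
      rw [Real.arccos_eq_pi] at h; linarith [hm.1]
  have ha := two_cpow_neg_crit (tOf lam)
  have hb := two_cpow_crit_sub_one (tOf lam)
  have hprod := two_cpow_mul_two_cpow (critPoint lam)
  have hpsi := psi_eq (critPoint lam)
  have hc := cFun_eq (critPoint lam)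
  have hc' := cFun_one_sub (critPoint lam)
  rw [← critPoint] at ha hb
  have hne : (2 : ℂ) ^ (-critPoint lam) - (2 : ℂ) ^ (critPoint lam - 1) ≠ 0 := by
    rw [ha, hb, ← mul_sub]
    refine mul_ne_zero (inv_ne_zero ofReal_sqrt_two_ne_zero) ?_
    rw [show ∀ u v : ℂ, u - v - (u + v) = -2 * v by intros; ring]
    exact mul_ne_zero (by norm_num) (mul_ne_zero (by exact_mod_cast hsin) Complex.I_ne_zero)
  have hsum : (2 : ℂ) ^ (-critPoint lam) + (2 : ℂ) ^ (critPoint lam - 1) = (3 - lam) / 2 := by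
    rw [ha, hb, hcos]
    push_cast
    have := ofReal_sqrt_two_ne_zero
    field_simp
    linear_combination -(3 - (lam : ℂ)) * ofReal_sqrt_two_sq
  set a := (2 : ℂ) ^ (-critPoint lam)
  set b := (2 : ℂ) ^ (critPoint lam - 1)
  have hlam : (lam : ℂ) = 3 - 2 * (a + b) := by linear_combination 2 * hsum
  have hrec : ∀ n, psi (critPoint lam) (n + 2) =
      (a + b) * psi (critPoint lam) (n + 1) - 1 / 2 * psi (critPoint lam) n := by
    intro n
    rw [← hprod, hpsi, hpsi, hpsi]
    ring
  have hne' : b - a ≠ 0 := by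
    rw [← neg_sub]; exact neg_ne_zero.2 hne
  induction n using Nat.strongRec with
  | ind n ih =>
    match n with
    | 0 =>
      rw [hpsi, hc, hc', radialPoly, hlam]
      rw [show b - a = -(a - b) by ring] at *
      push_cast
      field_simp
      ring
    | 1 =>
      rw [hpsi, hc, hc', radialPoly]
      push_cast
      rw [hlam, show b - a = -(a - b) by ring]
      field_simp
      linear_combination 12 * (a - b) * hprod
    | n + 2 =>
      rw [hrec, ih n (by omega), ih (n + 1) (by omega), radialPoly]
      push_cast
      rw [hlam]
      ring

theorem edgeKernel_eq_radialPoly {V : Type*} {G : SimpleGraph V} (hG : G.IsTree) {lam : ℝ}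
    (hl : lam ∈ interior specInterval) (x y : G.edgeSet) :
    edgeKernel G lam x y = ((2 / 3 * radialPoly (G.lineGraph.dist x y) lam : ℝ) : ℂ) := by
  rw [edgeKernel_eq_psi hG, psi_crit hl, inv_mul_cancel_left₀]
  have h6 : lam < 6 := by
    rw [interior_specInterval] at hl
    linarith [hl.2, two_mul_sqrt_two_lt]
  exact sub_ne_zero.2 fun h => h6.ne' (by exact_mod_cast h)

end Kernel

/-! ### The measure -/

section SpecMeasure

theorem one_le_nine_sub (θ : ℝ) : 1 ≤ 9 - 8 * Real.cos θ ^ 2 := by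
  linarith [Real.cos_sq_le_one θ]

theorem plancherelT_eq : plancherelT =
    (volume.restrict (Set.Icc 0 (Real.pi / Real.log 2))).withDensity fun t =>
    ENNReal.ofReal (Real.log 2 / (3 * Real.pi) * (36 * Real.sin (t * Real.log 2) ^ 2 /
      (9 - 8 * Real.cos (t * Real.log 2) ^ 2))) := by
  simp only [plancherelT, inv_norm_cFun_sq]

theorem continuous_plancherel_density : Continuous fun t : ℝ =>
    Real.log 2 / (3 * Real.pi) * (36 * Real.sin (t * Real.log 2) ^ 2 /
      (9 - 8 * Real.cos (t * Real.log 2) ^ 2)) := by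
  refine continuous_const.mul (Continuous.div (by fun_prop) (by fun_prop) fun t => ?_)
  linarith [one_le_nine_sub (t * Real.log 2)]

theorem continuous_specParam : Continuous fun t : ℝ => 3 - 2 * √2 * Real.cos (t * Real.log 2) := by
  fun_prop

theorem plancherel_density_nonneg (t : ℝ) :
    0 ≤ Real.log 2 / (3 * Real.pi) * (36 * Real.sin (t * Real.log 2) ^ 2 /
      (9 - 8 * Real.cos (t * Real.log 2) ^ 2)) := by
  have h1 := Real.log_pos one_lt_two
  have h2 := one_le_nine_sub (t * Real.log 2)
  have h3 : (0 : ℝ) < 9 - 8 * Real.cos (t * Real.log 2) ^ 2 := by linarith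
  positivity

instance isFiniteMeasure_specMeasure : IsFiniteMeasure specMeasure := by
  have : IsFiniteMeasure plancherelT := by
    rw [plancherelT_eq]
    exact isFiniteMeasure_withDensity_ofReal
      (continuous_plancherel_density.integrableOn_Icc (μ := volume)).2
  exact Measure.isFiniteMeasure_map _ _

theorem log_two_mul_mem {t : ℝ} (ht : t ∈ Set.Icc 0 (Real.pi / Real.log 2)) :
    t * Real.log 2 ∈ Set.Icc 0 Real.pi :=
  ⟨mul_nonneg ht.1 (Real.log_pos one_lt_two).le,
    (le_div_iff₀ (Real.log_pos one_lt_two)).1 ht.2⟩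

theorem image_specParam :
    (fun t : ℝ => 3 - 2 * √2 * Real.cos (t * Real.log 2)) ''
      Set.Icc 0 (Real.pi / Real.log 2) = specInterval := by
  have hlog := Real.log_pos one_lt_two
  ext lam
  simp only [Set.mem_image, specInterval]
  have h2 : (0 : ℝ) < 2 * √2 := by positivity
  constructor
  · rintro ⟨t, -, rfl⟩
    constructor
    · nlinarith [Real.cos_le_one (t * Real.log 2)]
    · nlinarith [Real.neg_one_le_cos (t * Real.log 2)]
  · rintro ⟨h, h'⟩
    refine ⟨Real.arccos ((3 - lam) / (2 * √2)) / Real.log 2,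
      ⟨div_nonneg (Real.arccos_nonneg _) hlog.le,
        div_le_div_of_nonneg_right (Real.arccos_le_pi _) hlog.le⟩, ?_⟩
    rw [div_mul_cancel₀ _ hlog.ne', Real.cos_arccos, mul_div_cancel₀ _ h2.ne']
    · ring
    · rw [le_div_iff₀ h2]; linarith
    · rw [div_le_iff₀ h2]; linarith

/-- Change of variables along the injective parametrisation. With θ = t log 2 one has lam (6 - lam)
= 9 - 8 cos² θ, and the square root is 2√2 sin θ. -/
theorem specMeasure_eq_withDensity : specMeasure =
    (volume.restrict specInterval).withDensity (fun lam =>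
      ENNReal.ofReal (3 * √(-lam ^ 2 + 6 * lam - 1) / (2 * Real.pi * (lam * (6 - lam))))) := by
  have hlog := Real.log_pos one_lt_two
  have hs2 : √2 ^ 2 = 2 := Real.sq_sqrt zero_le_two
  ext A hA
  have hm : MeasurableSet (Set.Icc 0 (Real.pi / Real.log 2) ∩
      (fun t : ℝ => 3 - 2 * √2 * Real.cos (t * Real.log 2)) ⁻¹' A) :=
    measurableSet_Icc.inter (continuous_specParam.measurable hA)
  rw [specMeasure, Measure.map_apply continuous_specParam.measurable hA, plancherelT_eq,
    withDensity_apply _ (continuous_specParam.measurable hA), withDensity_apply _ hA,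
    Measure.restrict_restrict (continuous_specParam.measurable hA), Measure.restrict_restrict hA,
    ← image_specParam, Set.inter_comm _ (Set.Icc _ _), Set.inter_comm A,
    ← Set.image_inter_preimage]
  rw [lintegral_image_eq_lintegral_abs_deriv_mul
    (f' := fun t => 2 * √2 * (Real.sin (t * Real.log 2) * Real.log 2)) hm]
  · refine setLIntegral_congr_fun hm fun t ht => ?_
    have hmem := log_two_mul_mem ht.1
    have hsin := Real.sin_nonneg_of_mem_Icc hmem
    have hcs := Real.sin_sq_add_cos_sq (t * Real.log 2)
    have hD := one_le_nine_sub (t * Real.log 2)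
    set s := Real.sin (t * Real.log 2)
    set c := Real.cos (t * Real.log 2)
    have h1 : √(-(3 - 2 * √2 * c) ^ 2 + 6 * (3 - 2 * √2 * c) - 1) = 2 * √2 * s := by
      rw [← Real.sqrt_sq (by positivity : 0 ≤ 2 * √2 * s)]
      congr 1
      linear_combination (-4 * c ^ 2 - 4 * s ^ 2) * hs2 - 8 * hcs
    have h2 : (3 - 2 * √2 * c) * (6 - (3 - 2 * √2 * c)) = 9 - 8 * c ^ 2 := by
      linear_combination (-4 * c ^ 2) * hs2
    rw [h1, h2, abs_of_nonneg (by positivity), ← ENNReal.ofReal_mul (by positivity)]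
    congr 1
    have hD' : 9 - 8 * c ^ 2 ≠ 0 := by linarith
    have := Real.pi_pos.ne'
    field_simp
    linear_combination (-18 * s ^ 2) * hs2
  · intro t _
    have h : HasDerivAt (fun t : ℝ => 3 - 2 * √2 * Real.cos (t * Real.log 2))
        (-(2 * √2 * (-Real.sin (t * Real.log 2) * (1 * Real.log 2)))) t :=
      (((hasDerivAt_id t).mul_const (Real.log 2)).cos.const_mul (2 * √2)).const_sub 3
    exact (h.congr_deriv (by ring)).hasDerivWithinAt
  · intro t ht t' ht' h
    have h2 : (0 : ℝ) < 2 * √2 := by positivity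
    have h' : Real.cos (t * Real.log 2) = Real.cos (t' * Real.log 2) := by
      have : 2 * √2 * Real.cos (t * Real.log 2) = 2 * √2 * Real.cos (t' * Real.log 2) := by
        linarith [show 3 - 2 * √2 * Real.cos (t * Real.log 2) =
          3 - 2 * √2 * Real.cos (t' * Real.log 2) from h]
      exact mul_left_cancel₀ h2.ne' this
    exact mul_right_cancel₀ hlog.ne'
      (Real.injOn_cos (log_two_mul_mem ht.1) (log_two_mul_mem ht'.1) h')

theorem ae_mem_interior_specInterval : ∀ᵐ lam ∂specMeasure, lam ∈ interior specInterval := by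
  rw [specMeasure_eq_withDensity]
  refine (withDensity_absolutelyContinuous _ _).ae_le ?_
  rw [interior_specInterval, specInterval, Measure.restrict_congr_set Ioo_ae_eq_Icc.symm]
  exact ae_restrict_mem measurableSet_Ioo

theorem memLp_of_continuous {g : ℝ → ℂ} (hg : Continuous g) (p : ℝ≥0∞) :
    MemLp g p specMeasure := by
  obtain ⟨C, hC⟩ := (isCompact_Icc (a := 3 - 2 * √2) (b := 3 + 2 * √2)).exists_bound_of_continuousOn
    hg.continuousOn
  refine MemLp.of_bound hg.aestronglyMeasurable C ?_
  filter_upwards [ae_mem_interior_specInterval] with lam hl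
  exact hC lam (interior_subset hl)

theorem integral_specMeasure {g : ℝ → ℝ} (hg : Continuous g) :
    ∫ lam, g lam ∂specMeasure = ∫ θ in (0 : ℝ)..Real.pi,
      12 / Real.pi * (Real.sin θ ^ 2 / (9 - 8 * Real.cos θ ^ 2)) *
        g (3 - 2 * √2 * Real.cos θ) := by
  have hlog := Real.log_pos one_lt_two
  have hpi := Real.pi_pos
  rw [specMeasure, integral_map continuous_specParam.aemeasurable hg.aestronglyMeasurable,
    plancherelT_eq, integral_withDensity_eq_integral_toReal_smul
      continuous_plancherel_density.measurable.ennreal_ofReal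
      (ae_of_all _ fun _ => ENNReal.ofReal_lt_top), integral_Icc_eq_integral_Ioc,
    ← intervalIntegral.integral_of_le (by positivity)]
  have h := intervalIntegral.integral_comp_mul_right (a := 0) (b := Real.pi / Real.log 2)
    (fun θ => Real.log 2 * (12 / Real.pi * (Real.sin θ ^ 2 / (9 - 8 * Real.cos θ ^ 2)) *
        g (3 - 2 * √2 * Real.cos θ))) hlog.ne'
  rw [zero_mul, div_mul_cancel₀ _ hlog.ne', intervalIntegral.integral_const_mul,
    intervalIntegral.integral_const_mul, smul_eq_mul, inv_mul_cancel_left₀ hlog.ne',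
    ← intervalIntegral.integral_const_mul] at h
  rw [← h]
  refine intervalIntegral.integral_congr fun t _ => ?_
  rw [ENNReal.toReal_ofReal (plancherel_density_nonneg t), smul_eq_mul]
  have hD := one_le_nine_sub (t * Real.log 2)
  have hD' : 9 - 8 * Real.cos (t * Real.log 2) ^ 2 ≠ 0 := by linarith
  field_simp
  ring

end SpecMeasure

/-! ### Orthogonality of the radial polynomials -/

section Orthogonality

/-- The Fourier coefficients of the weight `(9 - 8 cos² θ)⁻¹`. -/
def fourierCoef (j : ℤ) : ℝ :=
  ∫ θ in (0 : ℝ)..Real.pi, Real.cos (j * θ) / (9 - 8 * Real.cos θ ^ 2)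

theorem continuous_div_nine_sub {g : ℝ → ℝ} (hg : Continuous g) :
    Continuous fun θ => g θ / (9 - 8 * Real.cos θ ^ 2) :=
  hg.div (by fun_prop) fun θ => by linarith [one_le_nine_sub θ]

theorem intervalIntegrable_fourier (j : ℤ) :
    IntervalIntegrable (fun θ => Real.cos (j * θ) / (9 - 8 * Real.cos θ ^ 2)) volume 0 Real.pi :=
  (continuous_div_nine_sub (by fun_prop)).intervalIntegrable _ _

theorem fourierCoef_neg (j : ℤ) : fourierCoef (-j) = fourierCoef j := by
  simp only [fourierCoef, Int.cast_neg, neg_mul, Real.cos_neg]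

theorem integral_cos_int_mul (j : ℤ) :
    ∫ θ in (0 : ℝ)..Real.pi, Real.cos (j * θ) = if j = 0 then Real.pi else 0 := by
  split_ifs with h
  · simp [h]
  · rw [intervalIntegral.integral_comp_mul_left _ (by exact_mod_cast h : (j : ℝ) ≠ 0), integral_cos]
    simp [Real.sin_int_mul_pi]

/-- The weight is 1 / (5 - 4 cos 2θ); multiplying by its denominator shifts the frequency by 2
either way. -/
theorem fourierCoef_recurrence (j : ℤ) :
    5 * fourierCoef j - 2 * fourierCoef (j + 2) - 2 * fourierCoef (j - 2) =
      if j = 0 then Real.pi else 0 := by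
  rw [← integral_cos_int_mul]
  simp only [fourierCoef, ← intervalIntegral.integral_const_mul]
  rw [← intervalIntegral.integral_sub, ← intervalIntegral.integral_sub]
  · refine intervalIntegral.integral_congr fun θ _ => ?_
    have hD := one_le_nine_sub θ
    have hD' : 9 - 8 * Real.cos θ ^ 2 ≠ 0 := by linarith
    have h1 : Real.cos (((j + 2 : ℤ) : ℝ) * θ) + Real.cos (((j - 2 : ℤ) : ℝ) * θ) =
        2 * Real.cos (j * θ) * (2 * Real.cos θ ^ 2 - 1) := by
      rw [← Real.cos_two_mul]
      push_cast
      rw [add_mul, sub_mul, Real.cos_add, Real.cos_sub]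
      ring
    generalize Real.cos (((j + 2 : ℤ) : ℝ) * θ) = A at h1 ⊢
    generalize Real.cos (((j - 2 : ℤ) : ℝ) * θ) = B at h1 ⊢
    field_simp
    linear_combination (-2) * h1
  · exact ((intervalIntegrable_fourier _).const_mul _).sub ((intervalIntegrable_fourier _).const_mul _)
  · exact (intervalIntegrable_fourier _).const_mul _
  · exact (intervalIntegrable_fourier _).const_mul _
  · exact (intervalIntegrable_fourier _).const_mul _

theorem abs_fourierCoef_le (j : ℤ) : |fourierCoef j| ≤ Real.pi := by
  have h := intervalIntegral.norm_integral_le_of_norm_le_const (a := 0) (b := Real.pi) (C := 1)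
    (f := fun θ => Real.cos (j * θ) / (9 - 8 * Real.cos θ ^ 2)) fun θ _ => by
      have hD := one_le_nine_sub θ
      rw [norm_div, Real.norm_eq_abs, Real.norm_eq_abs,
        abs_of_pos (by linarith : (0 : ℝ) < 9 - 8 * Real.cos θ ^ 2)]
      exact div_le_one_of_le₀ ((Real.abs_cos_le_one _).trans hD) (by linarith)
  simpa [fourierCoef, abs_of_pos Real.pi_pos] using h

/-- The recurrence has characteristic roots 1/2 and 2. The defect from the decaying solution doubles
at every step, so boundedness of the coefficients forces it to be zero. -/
theorem fourierCoef_add_two (j : ℤ) (hj : 0 ≤ j) : fourierCoef (j + 2) = fourierCoef j / 2 := by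
  have hstep : ∀ i : ℤ, 0 ≤ i → fourierCoef (i + 2 + 2) - fourierCoef (i + 2) / 2 =
      2 * (fourierCoef (i + 2) - fourierCoef i / 2) := by
    intro i hi
    have h := fourierCoef_recurrence (i + 2)
    rw [if_neg (by omega), add_sub_cancel_right] at h
    linarith
  have hpow : ∀ k : ℕ, fourierCoef (j + 2 * k + 2) - fourierCoef (j + 2 * k) / 2 =
      2 ^ k * (fourierCoef (j + 2) - fourierCoef j / 2) := by
    intro k
    induction k with
    | zero => simp
    | succ k ih =>
      have h := hstep (j + 2 * k) (by positivity)
      rw [ih] at h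
      push_cast
      rw [pow_succ, show j + 2 * ((k : ℤ) + 1) = j + 2 * k + 2 by ring, h]
      ring
  by_contra hne
  have hpos : 0 < |fourierCoef (j + 2) - fourierCoef j / 2| :=
    abs_pos.2 (sub_ne_zero.2 hne)
  obtain ⟨k, hk⟩ := pow_unbounded_of_one_lt
    (2 * Real.pi / |fourierCoef (j + 2) - fourierCoef j / 2|) (one_lt_two : (1 : ℝ) < 2)
  rw [div_lt_iff₀ hpos] at hk
  have h1 := congrArg abs (hpow k)
  rw [abs_mul, abs_of_pos (by positivity : (0 : ℝ) < 2 ^ k)] at h1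
  have h2 := abs_sub (fourierCoef (j + 2 * k + 2)) (fourierCoef (j + 2 * k) / 2)
  have h3 := abs_fourierCoef_le (j + 2 * k + 2)
  have h4 := abs_fourierCoef_le (j + 2 * k)
  have h5 : |fourierCoef (j + 2 * k) / 2| = |fourierCoef (j + 2 * k)| / 2 := by
    rw [abs_div, abs_two]
  have := Real.pi_pos
  linarith

theorem fourierCoef_natCast (n : ℕ) :
    fourierCoef n = Real.pi / 6 * (√2)⁻¹ ^ n * (1 + (-1) ^ n) := by
  have hs : (√2)⁻¹ ^ 2 = 1 / 2 := by
    rw [inv_pow, Real.sq_sqrt zero_le_two]; norm_num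
  induction n using Nat.strongRec with
  | ind n ih =>
    match n with
    -- The starting values come from evenness: 5J₀ - 4J₂ = π with J₂ = J₀/2 here, and 5J₁ - 2J₃ -
    -- 2J₁ = 0 with J₃ = J₁/2 in the next case.
    | 0 =>
      have h1 := fourierCoef_recurrence 0
      have h2 := fourierCoef_add_two 0 le_rfl
      have h3 := fourierCoef_neg 2
      norm_num at h1 h2 h3 ⊢
      linarith
    | 1 =>
      have h1 := fourierCoef_recurrence 1
      have h2 := fourierCoef_add_two 1 zero_le_one
      have h3 := fourierCoef_neg 1
      norm_num at h1 h2 h3 ⊢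
      linarith
    | n + 2 =>
      have h := fourierCoef_add_two n (by positivity)
      push_cast
      rw [h, ih n (by omega), pow_add, pow_add, hs]
      ring

/-- A Chebyshev-type closed form. The factor sin θ is kept on the left to avoid dividing by zero;
the density supplies sin² θ, enough to absorb it. -/
theorem radialPoly_mul_sin (n : ℕ) (θ : ℝ) :
    radialPoly n (3 - 2 * √2 * Real.cos θ) * Real.sin θ =
      (√2)⁻¹ ^ n * (Real.cos (n * θ) * Real.sin θ + √2 / 4 * Real.sin (n * θ)) := by
  have hs0 : √2 ≠ 0 := by positivity
  have hs : √2 * (√2)⁻¹ = 1 := mul_inv_cancel₀ hs0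
  have hs1 : (√2)⁻¹ ^ 2 = 1 / 2 := by
    rw [inv_pow, Real.sq_sqrt zero_le_two]; norm_num
  have hs2 : √2 = 2 * (√2)⁻¹ := by
    linear_combination (-2 * √2) * hs1 + 2 * (√2)⁻¹ * hs
  induction n using Nat.strongRec with
  | ind n ih =>
    match n with
    | 0 => simp [radialPoly]
    | 1 =>
      simp only [radialPoly, pow_one, Nat.cast_one, one_mul]
      linear_combination (1 / 2 * Real.cos θ * Real.sin θ) * hs2 - (1 / 4 * Real.sin θ) * hs
    | n + 2 =>
      have h0 := ih n (by omega)
      have h1 := ih (n + 1) (by omega)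
      have ec : Real.cos (((n + 2 : ℕ) : ℝ) * θ) =
          2 * Real.cos θ * Real.cos (((n + 1 : ℕ) : ℝ) * θ) - Real.cos (n * θ) := by
        have e1 : ((n + 2 : ℕ) : ℝ) * θ = ((n + 1 : ℕ) : ℝ) * θ + θ := by push_cast; ring
        have e2 : (n : ℝ) * θ = ((n + 1 : ℕ) : ℝ) * θ - θ := by push_cast; ring
        rw [e1, e2, Real.cos_add, Real.cos_sub]
        ring
      have es : Real.sin (((n + 2 : ℕ) : ℝ) * θ) =
          2 * Real.cos θ * Real.sin (((n + 1 : ℕ) : ℝ) * θ) - Real.sin (n * θ) := by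
        have e1 : ((n + 2 : ℕ) : ℝ) * θ = ((n + 1 : ℕ) : ℝ) * θ + θ := by push_cast; ring
        have e2 : (n : ℝ) * θ = ((n + 1 : ℕ) : ℝ) * θ - θ := by push_cast; ring
        rw [e1, e2, Real.sin_add, Real.sin_sub]
        ring
      rw [radialPoly, ec, es, pow_add, hs1]
      rw [pow_succ] at h1
      linear_combination √2 * Real.cos θ * h1 - 1 / 2 * h0 +
        (√2)⁻¹ ^ n * Real.cos θ * (Real.cos (((n + 1 : ℕ) : ℝ) * θ) * Real.sin θ +
          √2 / 4 * Real.sin (((n + 1 : ℕ) : ℝ) * θ)) * hs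

theorem continuous_radialPoly (n : ℕ) : Continuous (radialPoly n) := by
  induction n using Nat.strongRec with
  | ind n ih =>
    match n with
    | 0 => exact continuous_const
    | 1 => exact (by fun_prop : Continuous fun lam : ℝ => 1 - lam / 4)
    | n + 2 =>
      have h0 := ih n (by omega)
      have h1 := ih (n + 1) (by omega)
      exact (by fun_prop : Continuous fun lam : ℝ =>
        ((3 - lam) * radialPoly (n + 1) lam - radialPoly n lam) / 2)

theorem integral_radialPoly_eq_fourierCoef (n : ℕ) :
    ∫ lam, radialPoly n lam ∂specMeasure = 12 / Real.pi * (√2)⁻¹ ^ n *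
      (1 / 2 * fourierCoef n - 1 / 4 * fourierCoef (n + 2) - 1 / 4 * fourierCoef (n - 2) +
        √2 / 8 * fourierCoef (n - 1) - √2 / 8 * fourierCoef (n + 1)) := by
  rw [integral_specMeasure (continuous_radialPoly n)]
  have hi : ∀ (c : ℝ) (j : ℤ), IntervalIntegrable
    (fun θ => c * (Real.cos (j * θ) / (9 - 8 * Real.cos θ ^ 2))) volume 0 Real.pi :=
    fun c j => (intervalIntegrable_fourier j).const_mul c
  simp only [fourierCoef]
  simp only [← intervalIntegral.integral_const_mul]
  rw [← intervalIntegral.integral_sub (hi _ _) (hi _ _),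
    ← intervalIntegral.integral_sub ((hi _ _).sub (hi _ _)) (hi _ _),
    ← intervalIntegral.integral_add (((hi _ _).sub (hi _ _)).sub (hi _ _)) (hi _ _),
    ← intervalIntegral.integral_sub ((((hi _ _).sub (hi _ _)).sub (hi _ _)).add (hi _ _)) (hi _ _),
    ← intervalIntegral.integral_const_mul]
  refine intervalIntegral.integral_congr fun θ _ => ?_
  have h := radialPoly_mul_sin n θ
  have hcs := Real.sin_sq_add_cos_sq θ
  push_cast
  rw [add_mul, sub_mul, sub_mul, add_mul, Real.cos_add, Real.cos_sub, Real.cos_add, Real.cos_sub,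
    one_mul, Real.cos_two_mul]
  have e : 12 / Real.pi * (Real.sin θ ^ 2 / (9 - 8 * Real.cos θ ^ 2)) *
      radialPoly n (3 - 2 * √2 * Real.cos θ) = 12 / Real.pi * (Real.sin θ *
      (radialPoly n (3 - 2 * √2 * Real.cos θ) * Real.sin θ)) / (9 - 8 * Real.cos θ ^ 2) := by
    ring
  rw [e, h]
  linear_combination (12 / Real.pi * (√2)⁻¹ ^ n * Real.cos (n * θ) / (9 - 8 * Real.cos θ ^ 2)) * hcs

theorem integral_radialPoly (n : ℕ) :
    2 / 3 * ∫ lam, radialPoly n lam ∂specMeasure =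
      (if n = 0 then 1 else 0) - 1 / 3 * (-1 / 2) ^ n := by
  have hpi := Real.pi_pos.ne'
  have hs0 : √2 ≠ 0 := by positivity
  have hs2 : √2 ^ 2 = 2 := Real.sq_sqrt zero_le_two
  have hs1 : (√2)⁻¹ ^ 2 = 1 / 2 := by
    rw [inv_pow, hs2]; norm_num
  have hc := fourierCoef_natCast
  rw [integral_radialPoly_eq_fourierCoef]
  match n with
  | 0 =>
    have h0 := hc 0
    have h1 := hc 1
    have h2 := hc 2
    have h3 := fourierCoef_neg 1
    have h4 := fourierCoef_neg 2
    rw [hs1] at h2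
    norm_num at h0 h1 h2 h3 h4 ⊢
    rw [h3, h4, h0, h1, h2]
    field_simp
    ring
  | 1 =>
    have h0 := hc 0
    have h1 := hc 1
    have h2 := hc 2
    have h3 := fourierCoef_neg 1
    have h4 := hc 3
    rw [hs1] at h2
    norm_num at h0 h1 h2 h3 h4 ⊢
    rw [h3, h4, h0, h1, h2]
    field_simp
    ring
  | n + 2 =>
    have h0 := hc n
    have h1 := hc (n + 1)
    have h2 := hc (n + 2)
    have h3 := hc (n + 3)
    have h4 := hc (n + 4)
    rw [if_neg (by omega)]
    push_cast at h0 h1 h2 h3 h4 ⊢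
    rw [show (n : ℤ) + 2 - 2 = n by ring, show (n : ℤ) + 2 - 1 = n + 1 by ring,
      show (n : ℤ) + 2 + 2 = n + 4 by ring, show (n : ℤ) + 2 + 1 = n + 3 by ring, h0, h1, h2, h3, h4]
    have e : (-1 / 2 : ℝ) ^ n = (√2)⁻¹ ^ n * (√2)⁻¹ ^ n * (-1) ^ n := by
      rw [← mul_pow, ← mul_pow, ← pow_two, hs1]; norm_num
    simp only [pow_add, e, hs1, show (√2)⁻¹ ^ 3 = 1 / 2 * (√2)⁻¹ by rw [pow_succ, hs1],
      show (√2)⁻¹ ^ 4 = 1 / 4 by rw [show 4 = 2 * 2 by norm_num, pow_mul, hs1]; norm_num]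
    field_simp
    ring

theorem integrable_of_continuous {g : ℝ → ℝ} (hg : Continuous g) : Integrable g specMeasure := by
  have h := (memLp_one_iff_integrable.1 (memLp_of_continuous
    (Complex.continuous_ofReal.comp hg) 1)).re
  simpa using h

/-- Multiplication by `lam` is symmetric, so the three-term recursion moves degree from one factor
to the other until the second is constant, where `integral_radialPoly` applies. -/
theorem integral_radialPoly_mul_radialPoly (k : ℕ) : ∀ n : ℕ,
    2 / 3 * ∫ lam, radialPoly n lam * radialPoly k lam ∂specMeasure =
      (if n = k then ((sphereSize n : ℝ))⁻¹ else 0) - 1 / 3 * (-1 / 2) ^ (n + k) := by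
  have hcont : ∀ n k, Continuous fun lam => radialPoly n lam * radialPoly k lam := fun n k =>
    (continuous_radialPoly n).mul (continuous_radialPoly k)
  have hint : ∀ n k (c : ℝ), Integrable (fun lam => c * (radialPoly n lam * radialPoly k lam))
      specMeasure := fun n k c => (integrable_of_continuous (hcont n k)).const_mul c
  have hzero : ∀ n, 2 / 3 * ∫ lam, radialPoly n lam * radialPoly 0 lam ∂specMeasure =
      (if n = 0 then ((sphereSize n : ℝ))⁻¹ else 0) - 1 / 3 * (-1 / 2) ^ n := by
    intro n
    simp only [radialPoly, mul_one]
    rw [integral_radialPoly]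
    rcases n with _ | n <;> simp [sphereSize]
  have hcomm : ∀ n k, ∫ lam, radialPoly n lam * radialPoly k lam ∂specMeasure =
      ∫ lam, radialPoly k lam * radialPoly n lam ∂specMeasure := fun n k => by
    simp only [mul_comm]
  induction k using Nat.strongRec with
  | ind k ih =>
    intro n
    match k, n with
    | 0, n => exact hzero n
    | k + 1, 0 =>
      rw [hcomm, hzero]
      simp
    | 1, m + 1 =>
      have h : ∫ lam, radialPoly (m + 1) lam * radialPoly 1 lam ∂specMeasure =
          1 / 4 * (∫ lam, radialPoly (m + 1) lam * radialPoly 0 lam ∂specMeasure) +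
          1 / 2 * (∫ lam, radialPoly (m + 2) lam * radialPoly 0 lam ∂specMeasure) +
          1 / 4 * (∫ lam, radialPoly m lam * radialPoly 0 lam ∂specMeasure) := by
        simp only [← integral_const_mul]
        rw [← integral_add (hint _ _ _) (hint _ _ _),
          ← integral_add]
        · refine integral_congr_ae (ae_of_all _ fun lam => ?_)
          simp only [radialPoly]
          ring
        · exact (hint _ _ _).add (hint _ _ _)
        · exact hint _ _ _
      have h0 := hzero (m + 1)
      have h1 := hzero (m + 2)
      have h2 := hzero m
      rw [h]
      rcases m with _ | m
      · norm_num [sphereSize] at h0 h1 h2 ⊢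
        linarith
      · norm_num [sphereSize, pow_succ] at h0 h1 h2 ⊢
        linarith
    | k + 2, m + 1 =>
      -- Expand (3 - lam) p_{m+1} p_{k+1} by the recursion in each factor and compare.
      have h : ∫ lam, radialPoly (m + 1) lam * radialPoly (k + 2) lam ∂specMeasure =
          1 * (∫ lam, radialPoly (m + 2) lam * radialPoly (k + 1) lam ∂specMeasure) +
          1 / 2 * (∫ lam, radialPoly m lam * radialPoly (k + 1) lam ∂specMeasure) -
          1 / 2 * (∫ lam, radialPoly (m + 1) lam * radialPoly k lam ∂specMeasure) := by
        simp only [← integral_const_mul]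
        rw [← integral_add (hint _ _ _) (hint _ _ _),
          ← integral_sub]
        · refine integral_congr_ae (ae_of_all _ fun lam => ?_)
          simp only [radialPoly]
          ring
        · exact (hint _ _ _).add (hint _ _ _)
        · exact hint _ _ _
      have h0 := ih (k + 1) (by omega) (m + 2)
      have h1 := ih (k + 1) (by omega) m
      have h2 := ih k (by omega) (m + 1)
      have e : (2 : ℝ) / 3 * ∫ lam, radialPoly (m + 1) lam * radialPoly (k + 2) lam ∂specMeasure =
          ((if m + 2 = k + 1 then ((sphereSize (m + 2) : ℝ))⁻¹ else 0) +
            1 / 2 * (if m = k + 1 then ((sphereSize m : ℝ))⁻¹ else 0) -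
            1 / 2 * (if m + 1 = k then ((sphereSize (m + 1) : ℝ))⁻¹ else 0)) -
          1 / 3 * (-1 / 2) ^ (m + 1 + (k + 2)) := by
        rw [h]
        linear_combination h0 + 1 / 2 * h1 - 1 / 2 * h2
      rw [e]
      congr 1
      -- Diagonal terms survive only for `m + 1 = k`, where they cancel, and for `m = k + 1`; in
      -- both cases because consecutive spheres beyond the centre double in size.
      rcases lt_trichotomy m (k + 1) with hlt | rfl | hgt
      · by_cases hk : m + 1 = k
        · subst hk
          rw [if_pos (by omega), if_neg (by omega), if_pos rfl, if_neg (by omega)]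
          simp [sphereSize, pow_succ]
          ring
        · rw [if_neg (by omega), if_neg (by omega), if_neg hk, if_neg (by omega)]
          ring
      · simp [sphereSize, pow_succ, show k + 1 + 1 ≠ k by omega]
        ring
      · rw [if_neg (by omega), if_neg (by omega), if_neg (by omega), if_neg (by omega)]
        ring

end Orthogonality

/-! ### Symmetry of the Laplacian -/

section Symmetry

variable {W : Type*} {H : SimpleGraph W} [H.LocallyFinite]

open Classical in
theorem hasSum_adj_eq_sum_neighborFinset {E : Type*} [AddCommMonoid E] [TopologicalSpace E]
    (y : W) (a : W → E) :
    HasSum (fun z => if H.Adj y z then a z else 0) (∑ z ∈ H.neighborFinset y, a z) := by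
  have h := hasSum_sum_of_ne_finset_zero (f := fun z => if H.Adj y z then a z else 0)
    (s := H.neighborFinset y) (L := .unconditional W) fun z hz => if_neg (by simpa using hz)
  rwa [Finset.sum_congr rfl fun z hz => if_pos (by simpa using hz)] at h

open Classical in
theorem summable_adj_of_summable {d : ℕ} (hd : H.IsRegularOfDegree d) {a : W → ℝ} (ha : ∀ y, 0 ≤ a y)
    (hs : Summable a) : Summable fun p : W × W => if H.Adj p.1 p.2 then a p.1 else 0 := by
  rw [summable_prod_of_nonneg fun p => by dsimp only; split_ifs <;> simp [ha]]
  refine ⟨fun y => (hasSum_adj_eq_sum_neighborFinset y fun _ => a y).summable, ?_⟩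
  have h : ∀ y, ∑' z, (if H.Adj y z then a y else 0) = d * a y := fun y => by
    rw [(hasSum_adj_eq_sum_neighborFinset y fun _ => a y).tsum_eq, Finset.sum_const,
      H.card_neighborFinset_eq_degree, hd y, nsmul_eq_mul]
  simp only [h]
  exact hs.mul_left _

open Classical in
theorem summable_adj_mul {d : ℕ} (hd : H.IsRegularOfDegree d) {u v : W → ℂ}
    (hu : Summable fun y => ‖u y‖ ^ 2) (hv : Summable fun y => ‖v y‖ ^ 2) :
    Summable fun p : W × W => if H.Adj p.1 p.2 then u p.2 * v p.1 else 0 := by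
  have h1 := summable_adj_of_summable hd (fun y => sq_nonneg ‖v y‖) hv
  have h2 := (Equiv.prodComm W W).summable_iff.2
    (summable_adj_of_summable hd (fun y => sq_nonneg ‖u y‖) hu)
  refine Summable.of_norm_bounded (h1.add h2) fun p => ?_
  simp only [Function.comp, Equiv.prodComm_apply, Prod.fst_swap, Prod.snd_swap, H.adj_comm p.2]
  split_ifs
  · rw [norm_mul]
    nlinarith [sq_nonneg (‖u p.2‖ - ‖v p.1‖), sq_nonneg ‖u p.2‖, sq_nonneg ‖v p.1‖]
  · simp

theorem negLaplacian_apply {d : ℕ} (hd : H.IsRegularOfDegree d) (u : W → ℂ) (y : W) :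
    negLaplacian H u y = d * u y - ∑ z ∈ H.neighborFinset y, u z := by
  show ∑ z ∈ H.neighborFinset y, (u y - u z) = _
  rw [Finset.sum_sub_distrib, Finset.sum_const, H.card_neighborFinset_eq_degree, hd y,
    nsmul_eq_mul]

/-- Green's formula. The sum of u(z) v(y) over ordered adjacent pairs converges absolutely because
degrees are bounded, so the two coordinates may be exchanged. -/
theorem hasSum_negLaplacian_mul_sub {d : ℕ} (hd : H.IsRegularOfDegree d) {u v : W → ℂ}
    (hu : Summable fun y => ‖u y‖ ^ 2) (hv : Summable fun y => ‖v y‖ ^ 2) :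
    HasSum (fun y => negLaplacian H u y * v y - u y * negLaplacian H v y) 0 := by
  classical
  have hs := (summable_adj_mul hd hu hv).hasSum
  have hs' := (Equiv.prodComm W W).hasSum_iff.2 hs
  have h1 := hs.prod_fiberwise fun y =>
    hasSum_adj_eq_sum_neighborFinset (H := H) y fun z => u z * v y
  have h2 := hs'.prod_fiberwise (g := fun y => ∑ z ∈ H.neighborFinset y, u y * v z) fun y => by
    refine (hasSum_adj_eq_sum_neighborFinset (H := H) y fun z => u y * v z).congr_fun fun z => ?_
    simp [H.adj_comm y z]
  have h := h2.sub h1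
  rw [sub_self] at h
  refine h.congr_fun fun y => ?_
  rw [negLaplacian_apply hd, negLaplacian_apply hd, ← Finset.mul_sum, ← Finset.sum_mul]
  ring

end Symmetry

/-! ### Square summable radial functions -/

section Radial

variable {V : Type*} {G : SimpleGraph V} [G.LocallyFinite]

open Classical in
theorem card_filter_dist_le (hG : G.IsTree) (h3 : G.IsRegularOfDegree 3) (x : G.edgeSet)
    (t : Finset G.edgeSet) (n : ℕ) :
    (t.filter fun y => G.lineGraph.dist x y = n).card ≤ sphereSize n := by
  obtain ⟨S, hS, hc⟩ := exists_sphere hG h3 x n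
  refine (Finset.card_le_card fun y hy => ?_).trans hc
  exact (hS y).2 (Finset.mem_filter.1 hy).2

theorem summable_radial (hG : G.IsTree) (h3 : G.IsRegularOfDegree 3) (x : G.edgeSet) {f : ℕ → ℝ}
    (hf : ∀ n, 0 ≤ f n) (hs : Summable fun n => sphereSize n * f n) :
    Summable fun y => f (G.lineGraph.dist x y) := by
  classical
  refine summable_of_sum_le (fun y => hf _) (c := ∑' n, sphereSize n * f n) fun t => ?_
  rw [Finset.sum_comp f]
  refine (Finset.sum_le_sum fun n _ => ?_).trans
    (hs.sum_le_tsum _ fun n _ => mul_nonneg (Nat.cast_nonneg _) (hf n))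
  rw [nsmul_eq_mul]
  exact mul_le_mul_of_nonneg_right (by exact_mod_cast card_filter_dist_le hG h3 x t n) (hf n)

theorem sphereSize_le (n : ℕ) : (sphereSize n : ℝ) ≤ 2 * 2 ^ n := by
  rcases n with _ | n
  · norm_num [sphereSize]
  · rw [sphereSize, pow_succ]
    push_cast
    linarith

/-- Used with `k = 0` for the projection kernel and `k = 2` for its potential, whose extra factor is
linear in the distance. -/
theorem summable_sphereSize_mul (k : ℕ) :
    Summable fun n => (sphereSize n : ℝ) * ((n : ℝ) ^ k * (1 / 4) ^ n) := by
  have h := (summable_pow_mul_geometric_of_norm_lt_one (R := ℝ) k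
    (r := 1 / 2) (by norm_num)).mul_left 2
  refine Summable.of_nonneg_of_le (fun n => by positivity) (fun n => ?_) h
  calc (sphereSize n : ℝ) * ((n : ℝ) ^ k * (1 / 4) ^ n)
      ≤ 2 * 2 ^ n * ((n : ℝ) ^ k * (1 / 4) ^ n) :=
        mul_le_mul_of_nonneg_right (sphereSize_le n) (by positivity)
    _ = 2 * ((n : ℝ) ^ k * (1 / 2) ^ n) := by
        rw [show (1 / 2 : ℝ) = 2 * (1 / 4) by norm_num, mul_pow]; ring

theorem isRegularOfDegree_lineGraph (hG : G.IsTree) (h3 : G.IsRegularOfDegree 3) :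
    G.lineGraph.IsRegularOfDegree 4 := by
  intro y
  have h := (sum_neighborFinset_lineGraph_dist hG h3 (fun _ => (1 : ℤ)) y y).1
    SimpleGraph.dist_self
  rw [Finset.sum_const, SimpleGraph.card_neighborFinset_eq_degree] at h
  have h' : ((G.lineGraph.degree y : ℕ) : ℤ) = 4 := by simpa using h
  exact_mod_cast h'

theorem negLaplacian_radial (hG : G.IsTree) (h3 : G.IsRegularOfDegree 3) (f : ℕ → ℂ)
    (x y : G.edgeSet) :
    (G.lineGraph.dist x y = 0 →
      negLaplacian G.lineGraph (fun z => f (G.lineGraph.dist x z)) y = 4 * f 0 - 4 * f 1) ∧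
    ∀ n, G.lineGraph.dist x y = n + 1 →
      negLaplacian G.lineGraph (fun z => f (G.lineGraph.dist x z)) y =
        3 * f (n + 1) - f n - 2 * f (n + 2) := by
  have h := sum_neighborFinset_lineGraph_dist hG h3 f x y
  rw [negLaplacian_apply (isRegularOfDegree_lineGraph hG h3)]
  refine ⟨fun hd => ?_, fun n hd => ?_⟩
  · rw [h.1 hd, hd]; norm_num
  · rw [h.2 n hd, hd]; push_cast; ring

/-- The kernel `y ↦ (1/3) (-1/2)^{d(x, y)}` of the projection onto the `6`-eigenspace. -/
def projSixKernel (G : SimpleGraph V) (x y : G.edgeSet) : ℂ :=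
  (1 / 3) * (-1 / 2) ^ G.lineGraph.dist x y

/-- A function `u` with `-Δ u - 6 u = δ_x - projSixKernel x`. -/
def projSixPotential (G : SimpleGraph V) (x y : G.edgeSet) : ℂ :=
  (G.lineGraph.dist x y / 3) * (-1 / 2) ^ G.lineGraph.dist x y

theorem norm_neg_half_pow_sq (n : ℕ) : (‖(-1 / 2 : ℂ)‖ ^ n) ^ 2 = (1 / 4) ^ n := by
  rw [← pow_mul, mul_comm, pow_mul]
  norm_num

theorem summable_projSixKernel (hG : G.IsTree) (h3 : G.IsRegularOfDegree 3) (x : G.edgeSet) :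
    Summable fun y => ‖projSixKernel G x y‖ ^ 2 := by
  have h := (summable_radial hG h3 x (f := fun n => (n : ℝ) ^ 0 * (1 / 4) ^ n)
    (fun n => by positivity) (summable_sphereSize_mul 0)).mul_left (1 / 9)
  refine h.congr fun y => ?_
  rw [projSixKernel, norm_mul, norm_pow, mul_pow, norm_neg_half_pow_sq]
  norm_num

theorem summable_projSixPotential (hG : G.IsTree) (h3 : G.IsRegularOfDegree 3) (x : G.edgeSet) :
    Summable fun y => ‖projSixPotential G x y‖ ^ 2 := by
  have h := (summable_radial hG h3 x (f := fun n => (n : ℝ) ^ 2 * (1 / 4) ^ n)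
    (fun n => by positivity) (summable_sphereSize_mul 2)).mul_left (1 / 9)
  refine h.congr fun y => ?_
  rw [projSixPotential, norm_mul, norm_pow, mul_pow, norm_neg_half_pow_sq, norm_div,
    Complex.norm_natCast]
  norm_num
  ring

theorem negLaplacian_projSixKernel (hG : G.IsTree) (h3 : G.IsRegularOfDegree 3)
    (x y : G.edgeSet) :
    negLaplacian G.lineGraph (projSixKernel G x) y = 6 * projSixKernel G x y := by
  have h := negLaplacian_radial hG h3 (fun n => (1 / 3) * (-1 / 2) ^ n) x y
  change negLaplacian G.lineGraph (fun z => (1 / 3) * (-1 / 2) ^ (G.lineGraph.dist x z)) y = _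
  cases hd : G.lineGraph.dist x y with
  | zero => rw [h.1 hd, projSixKernel, hd]; norm_num
  | succ n => rw [h.2 n hd, projSixKernel, hd, pow_succ, pow_add]; ring

open Classical in
theorem negLaplacian_projSixPotential (hG : G.IsTree) (h3 : G.IsRegularOfDegree 3)
    (x y : G.edgeSet) :
    negLaplacian G.lineGraph (projSixPotential G x) y =
      6 * projSixPotential G x y + (if y = x then 1 else 0) - projSixKernel G x y := by
  have h := negLaplacian_radial hG h3 (fun n => (n / 3) * (-1 / 2) ^ n) x y
  change negLaplacian G.lineGraph
    (fun z => ((G.lineGraph.dist x z : ℕ) / 3) * (-1 / 2) ^ (G.lineGraph.dist x z)) y = _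
  have hxy : y = x ↔ G.lineGraph.dist x y = 0 := by
    rw [(lineGraph_connected hG x y).dist_eq_zero_iff, eq_comm]
  cases hd : G.lineGraph.dist x y with
  | zero =>
    rw [h.1 hd, projSixPotential, projSixKernel, hd, if_pos (hxy.2 hd)]
    norm_num
  | succ n =>
    rw [h.2 n hd, projSixPotential, projSixKernel, hd, if_neg (by rw [hxy, hd]; omega), pow_succ,
      pow_add]
    push_cast
    ring

theorem summable_norm_sq_coe {W : Type*} (F : L2 W) : Summable fun y => ‖F y‖ ^ 2 := by
  simpa using (lp.memℓp F).summable (by norm_num)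

open Classical in
-- Pair the 6-eigenfunction with the equation (-Δ - 6) u = δ_x - q_x for the potential u and kernel
-- q_x: by Green's formula the left side contributes zero.
theorem hasSum_projSixKernel_mul (hG : G.IsTree) (h3 : G.IsRegularOfDegree 3) (x : G.edgeSet)
    {F : L2 G.edgeSet} (hF : F ∈ eigenspaceL2 G.lineGraph 6) :
    HasSum (fun y => projSixKernel G x y * F y) (F x) := by
  have h := hasSum_negLaplacian_mul_sub (isRegularOfDegree_lineGraph hG h3)
    (summable_projSixPotential hG h3 x) (summable_norm_sq_coe F)
  have hF' : negLaplacian G.lineGraph (F : G.edgeSet → ℂ) = (6 : ℂ) • (F : G.edgeSet → ℂ) := hF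
  have h1 := hasSum_ite_eq x (F x)
  rw [← sub_zero (F x)]
  refine (h1.sub h).congr_fun fun y => ?_
  rw [negLaplacian_projSixPotential hG h3, hF', Pi.smul_apply, smul_eq_mul]
  by_cases hy : y = x
  · subst hy
    simp only [if_true]
    ring
  · simp only [if_neg hy]
    ring

theorem hasSum_projSix (hG : G.IsTree) (h3 : G.IsRegularOfDegree 3) (F : L2 G.edgeSet)
    (x : G.edgeSet) :
    HasSum (fun y => projSixKernel G x y * F y) (projSix G F x) := by
  classical
  have hq : Memℓp (projSixKernel G x) 2 :=
    memℓp_gen (by simpa using summable_projSixKernel hG h3 x)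
  let q : L2 G.edgeSet := ⟨projSixKernel G x, hq⟩
  have hreal : ∀ y, (starRingEnd ℂ) (projSixKernel G x y) = projSixKernel G x y := fun y => by
    simp [projSixKernel, map_ofNat]
  have hinner : ∀ F : L2 G.edgeSet,
      HasSum (fun y => projSixKernel G x y * F y) (inner ℂ q F) := fun F => by
    refine (lp.hasSum_inner (𝕜 := ℂ) q F).congr_fun fun y => ?_
    rw [RCLike.inner_apply]
    show _ = F y * (starRingEnd ℂ) (projSixKernel G x y)
    rw [hreal, mul_comm]
  have hsingle : ∀ F : L2 G.edgeSet, inner ℂ (lp.single 2 x (1 : ℂ) : L2 G.edgeSet) F = F x :=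
    fun F => by
      rw [lp.inner_single_left, RCLike.inner_apply]
      simp
  -- The kernel lies in the eigenspace, and by its reproducing property its difference from the
  -- Dirac mass is orthogonal to it. Self-adjointness then gives the projection of any `F`.
  have hproj : projSix G (lp.single 2 x (1 : ℂ)) = q := by
    refine Submodule.eq_starProjection_of_mem_of_inner_eq_zero ?_ fun K hK => ?_
    · exact funext fun y => negLaplacian_projSixKernel hG h3 x y
    · rw [inner_sub_left, hsingle, (hinner K).unique (hasSum_projSixKernel_mul hG h3 x hK),
        sub_self]
  have h := hinner F
  rwa [← hproj, projSix, Submodule.inner_starProjection_left_eq_right, hsingle] at h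

end Radial

/-! ### The kernel in `L²(m)` -/

section KernelLp

variable {V : Type*} {G : SimpleGraph V}

theorem edgeKernel_ae_eq (hG : G.IsTree) (x y : G.edgeSet) :
    (fun lam => edgeKernel G lam x y) =ᵐ[specMeasure]
      fun lam => ((2 / 3 * radialPoly (G.lineGraph.dist x y) lam : ℝ) : ℂ) := by
  filter_upwards [ae_mem_interior_specInterval] with lam hl
  exact edgeKernel_eq_radialPoly hG hl x y

theorem memLp_edgeKernel (hG : G.IsTree) (x y : G.edgeSet) (p : ℝ≥0∞) :
    MemLp (fun lam => edgeKernel G lam x y) p specMeasure :=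
  (memLp_congr_ae (edgeKernel_ae_eq hG x y)).2 (memLp_of_continuous
    (Complex.continuous_ofReal.comp (continuous_const.mul (continuous_radialPoly _))) p)

/-- The kernel `lam ↦ edgeKernel G lam x y` as an element of `L²(m)`. -/
def kernelLp (hG : G.IsTree) (x y : G.edgeSet) : Lp ℂ 2 specMeasure :=
  (memLp_edgeKernel hG x y 2).toLp

theorem inner_kernelLp (hG : G.IsTree) (x y z : G.edgeSet) :
    inner ℂ (kernelLp hG x y) (kernelLp hG x z) = ((2 / 3 *
      ((if G.lineGraph.dist x y = G.lineGraph.dist x z then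
        ((sphereSize (G.lineGraph.dist x y) : ℝ))⁻¹ else 0) -
      1 / 3 * (-1 / 2) ^ (G.lineGraph.dist x y + G.lineGraph.dist x z)) : ℝ) : ℂ) := by
  rw [← integral_radialPoly_mul_radialPoly, L2.inner_def, ← mul_assoc, ← integral_const_mul,
    ← integral_complex_ofReal]
  refine integral_congr_ae ?_
  filter_upwards [(memLp_edgeKernel hG x y 2).coeFn_toLp, (memLp_edgeKernel hG x z 2).coeFn_toLp,
    edgeKernel_ae_eq hG x y, edgeKernel_ae_eq hG x z] with lam h1 h2 h3 h4
  rw [kernelLp, kernelLp, h1, h2, h3, h4, RCLike.inner_apply, Complex.conj_ofReal]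
  push_cast
  ring

theorem memLp_partialSum (hG : G.IsTree) (F : G.edgeSet → ℂ) (x : G.edgeSet)
    (s : Finset G.edgeSet) (p : ℝ≥0∞) :
    MemLp (fun lam => ∑ y ∈ s, edgeKernel G lam x y * F y) p specMeasure :=
  memLp_finsetSum s fun y _ => (memLp_edgeKernel hG x y p).mul_const (F y)

theorem coeFn_sum_kernelLp (hG : G.IsTree) (F : G.edgeSet → ℂ) (x : G.edgeSet)
    (s : Finset G.edgeSet) :
    (∑ y ∈ s, F y • kernelLp hG x y : Lp ℂ 2 specMeasure) =ᵐ[specMeasure]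
      fun lam => ∑ y ∈ s, edgeKernel G lam x y * F y := by
  have h : ∀ y ∈ s, (F y • kernelLp hG x y : Lp ℂ 2 specMeasure) =ᵐ[specMeasure]
      fun lam => edgeKernel G lam x y * F y := fun y _ => by
    filter_upwards [Lp.coeFn_smul (F y) (kernelLp hG x y),
      (memLp_edgeKernel hG x y 2).coeFn_toLp] with lam h1 h2
    rw [h1, Pi.smul_apply, kernelLp, h2, smul_eq_mul, mul_comm]
  have h' := (eventually_countable_ball s.countable_toSet).2 h
  filter_upwards [Lp.coeFn_fun_finsetSum s fun y => F y • kernelLp hG x y, h'] with lam h1 h2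
  rw [h1]
  exact Finset.sum_congr rfl h2

theorem hasSum_kernelLp_iff (hG : G.IsTree) (F : G.edgeSet → ℂ) (x : G.edgeSet) {g : ℝ → ℂ}
    (hg : MemLp g 2 specMeasure) :
    HasSum (fun y => F y • kernelLp hG x y) hg.toLp ↔
      Tendsto (fun s : Finset G.edgeSet =>
        eLpNorm (fun lam => g lam - ∑ y ∈ s, edgeKernel G lam x y * F y) 2 specMeasure)
      atTop (𝓝 0) := by
  rw [HasSum, SummationFilter.unconditional_filter, Lp.tendsto_Lp_iff_tendsto_eLpNorm']
  refine tendsto_congr fun s => ?_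
  rw [eLpNorm_sub_comm]
  refine eLpNorm_congr_ae ?_
  filter_upwards [hg.coeFn_toLp, coeFn_sum_kernelLp hG F x s] with lam h1 h2
  rw [Pi.sub_apply, h1, h2]

/-- The Gram matrix is 2/3 of `A` minus a positive rank-one matrix, which may be dropped. `A` is
nonnegative and symmetric with row sums at most 1, each row spreading the reciprocal of a sphere
size over that sphere, so Schur's test applies. -/
theorem norm_sum_kernelLp_sq_le [G.LocallyFinite] (hG : G.IsTree) (h3 : G.IsRegularOfDegree 3)
    (F : G.edgeSet → ℂ) (x : G.edgeSet) (t : Finset G.edgeSet) :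
    ‖∑ y ∈ t, F y • kernelLp hG x y‖ ^ 2 ≤ 2 / 3 * ∑ y ∈ t, ‖F y‖ ^ 2 := by
  classical
  set d := fun y => G.lineGraph.dist x y
  set A : G.edgeSet → G.edgeSet → ℝ := fun y z =>
    if d y = d z then ((sphereSize (d y) : ℝ))⁻¹ else 0 with hA
  have hA0 : ∀ y z, 0 ≤ A y z := fun y z => by
    simp only [hA]; split_ifs <;> positivity
  have hAsymm : ∀ y z, A y z = A z y := fun y z => by
    simp only [hA]
    by_cases h : d y = d z
    · rw [if_pos h, if_pos h.symm, h]
    · rw [if_neg h, if_neg (Ne.symm h)]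
  have hAsum : ∀ y, ∑ z ∈ t, A y z ≤ 1 := fun y => by
    simp only [hA]
    rw [← Finset.sum_filter, Finset.sum_const, nsmul_eq_mul]
    have h := card_filter_dist_le hG h3 x t (d y)
    have h' : ((t.filter fun z => d y = d z).card : ℝ) ≤ sphereSize (d y) := by
      simp only [eq_comm (a := d y)]
      exact_mod_cast h
    exact (mul_le_mul_of_nonneg_right h' (by positivity)).trans mul_inv_le_one
  have hexp : ((‖∑ y ∈ t, F y • kernelLp hG x y‖ ^ 2 : ℝ) : ℂ) =
      2 / 3 * ∑ y ∈ t, ∑ z ∈ t, (starRingEnd ℂ) (F y) * F z * A y z -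
        2 / 9 * ((starRingEnd ℂ) (∑ y ∈ t, F y * (-1 / 2) ^ d y) *
          ∑ y ∈ t, F y * (-1 / 2) ^ d y) := by
    have h := inner_self_eq_norm_sq_to_K (𝕜 := ℂ) (∑ y ∈ t, F y • kernelLp hG x y)
    push_cast
    refine Eq.trans h.symm ?_
    rw [sum_inner, map_sum, Finset.sum_mul_sum, Finset.mul_sum, Finset.mul_sum,
      ← Finset.sum_sub_distrib]
    refine Finset.sum_congr rfl fun y _ => ?_
    rw [inner_sum, Finset.mul_sum, Finset.mul_sum, ← Finset.sum_sub_distrib]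
    refine Finset.sum_congr rfl fun z _ => ?_
    rw [inner_smul_left, inner_smul_right, inner_kernelLp]
    simp only [hA, d, map_mul, map_pow, map_div₀, map_neg, map_one, map_ofNat]
    push_cast
    rw [pow_add]
    ring
  have hre := congrArg Complex.re hexp
  rw [Complex.ofReal_re] at hre
  have hneg : 0 ≤ ((2 / 9 : ℂ) * ((starRingEnd ℂ) (∑ y ∈ t, F y * (-1 / 2) ^ d y) *
      ∑ y ∈ t, F y * (-1 / 2) ^ d y)).re := by
    rw [← Complex.normSq_eq_conj_mul_self, show (2 / 9 : ℂ) = ((2 / 9 : ℝ) : ℂ) by norm_num,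
      ← Complex.ofReal_mul, Complex.ofReal_re]
    exact mul_nonneg (by norm_num) (Complex.normSq_nonneg _)
  have hmain : ((2 / 3 : ℂ) * ∑ y ∈ t, ∑ z ∈ t, (starRingEnd ℂ) (F y) * F z * A y z).re ≤
      2 / 3 * ∑ y ∈ t, ‖F y‖ ^ 2 := by
    rw [show (2 / 3 : ℂ) = ((2 / 3 : ℝ) : ℂ) by norm_num, Complex.re_ofReal_mul, Complex.re_sum]
    refine mul_le_mul_of_nonneg_left ?_ (by norm_num)
    calc ∑ y ∈ t, (∑ z ∈ t, (starRingEnd ℂ) (F y) * F z * A y z).re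
        ≤ ∑ y ∈ t, ∑ z ∈ t, (‖F y‖ ^ 2 / 2 * A y z + ‖F z‖ ^ 2 / 2 * A z y) := by
          refine Finset.sum_le_sum fun y _ => ?_
          rw [Complex.re_sum]
          refine Finset.sum_le_sum fun z _ => ?_
          rw [Complex.re_mul_ofReal, hAsymm z y, ← add_mul]
          refine mul_le_mul_of_nonneg_right ?_ (hA0 y z)
          refine (Complex.re_le_norm _).trans ?_
          rw [norm_mul, RCLike.norm_conj]
          nlinarith [sq_nonneg (‖F y‖ - ‖F z‖)]
      _ = ∑ y ∈ t, ‖F y‖ ^ 2 * ∑ z ∈ t, A y z := by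
          simp only [Finset.sum_add_distrib]
          rw [Finset.sum_comm (f := fun y z => ‖F z‖ ^ 2 / 2 * A z y), ← Finset.sum_add_distrib]
          refine Finset.sum_congr rfl fun y _ => ?_
          rw [← Finset.mul_sum]
          ring
      _ ≤ ∑ y ∈ t, ‖F y‖ ^ 2 := Finset.sum_le_sum fun y _ =>
          mul_le_of_le_one_right (sq_nonneg _) (hAsum y)
  rw [hre, Complex.sub_re]
  linarith

theorem summable_smul_kernelLp [G.LocallyFinite] (hG : G.IsTree) (h3 : G.IsRegularOfDegree 3)
    (F : L2 G.edgeSet) (x : G.edgeSet) : Summable fun y => F y • kernelLp hG x y := by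
  rw [summable_iff_vanishing_norm]
  intro ε hε
  obtain ⟨s, hs⟩ := summable_iff_vanishing_norm.1 (summable_norm_sq_coe F) (ε ^ 2) (by positivity)
  refine ⟨s, fun t ht => ?_⟩
  have h1 := norm_sum_kernelLp_sq_le hG h3 F x t
  have h2 := (le_abs_self _).trans_lt (hs t ht)
  have h3 : 0 ≤ ∑ y ∈ t, ‖F y‖ ^ 2 := Finset.sum_nonneg fun _ _ => sq_nonneg _
  exact lt_of_pow_lt_pow_left₀ 2 hε.le (by linarith)

theorem IsKernelTransform.integrable {F : G.edgeSet → ℂ} {PF : ℝ → G.edgeSet → ℂ}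
    (h : IsKernelTransform G F PF) (x : G.edgeSet) :
    Integrable (fun lam => PF lam x) specMeasure :=
  (h x).1.integrable one_le_two

theorem IsKernelTransform.hasSum_integral (hG : G.IsTree)
    {F : G.edgeSet → ℂ} {PF : ℝ → G.edgeSet → ℂ} (h : IsKernelTransform G F PF)
    (x : G.edgeSet) :
    HasSum (fun y => inner ℂ (kernelLp hG x x) (F y • kernelLp hG x y))
      (2 / 3 * ∫ lam, PF lam x ∂specMeasure) := by
  have hs := (hasSum_kernelLp_iff hG F x (h x).1).2 (h x).2
  have hi := hs.mapL (innerSL ℂ (kernelLp hG x x))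
  simp only [innerSL_apply_apply] at hi
  -- At distance 0 the kernel is almost everywhere the constant 2/3, so pairing with it is
  -- integration.
  have key : inner ℂ (kernelLp hG x x) (h x).1.toLp = 2 / 3 * ∫ lam, PF lam x ∂specMeasure := by
    rw [L2.inner_def, ← integral_const_mul]
    refine integral_congr_ae ?_
    filter_upwards [(memLp_edgeKernel hG x x 2).coeFn_toLp, (h x).1.coeFn_toLp,
      edgeKernel_ae_eq hG x x] with lam h1 h2 h3
    rw [kernelLp, h1, h2, h3, RCLike.inner_apply, Complex.conj_ofReal, SimpleGraph.dist_self]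
    simp only [radialPoly]
    push_cast
    ring
  rwa [key] at hi

end KernelLp

/-! ### The kernel transform -/

section Transform

variable {V : Type*} {G : SimpleGraph V} [G.LocallyFinite]

theorem exists_isKernelTransform (hG : G.IsTree) (h3 : G.IsRegularOfDegree 3)
    (F : L2 G.edgeSet) : ∃ PF : ℝ → G.edgeSet → ℂ, IsKernelTransform G F PF := by
  refine ⟨fun lam x => (∑' y, F y • kernelLp hG x y : Lp ℂ 2 specMeasure) lam, fun x => ?_⟩
  refine ⟨Lp.memLp _, ?_⟩
  have h := (summable_smul_kernelLp hG h3 F x).hasSum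
  rw [← Lp.toLp_coeFn (∑' y, F y • kernelLp hG x y) (Lp.memLp _)] at h
  exact (hasSum_kernelLp_iff hG F x (Lp.memLp _)).1 h

theorem IsKernelTransform.ae_eq_tsum (hG : G.IsTree) (h3 : G.IsRegularOfDegree 3)
    {F : G.edgeSet → ℂ} {PF : ℝ → G.edgeSet → ℂ} (h : IsKernelTransform G F PF) :
    ∀ᵐ lam ∂specMeasure, ∀ x : G.edgeSet,
      Summable (fun y : G.edgeSet => edgeKernel G lam x y * F y) →
        PF lam x = ∑' y : G.edgeSet, edgeKernel G lam x y * F y := by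
  have := countable_edgeSet hG h3
  rw [ae_all_iff]
  intro x
  obtain ⟨hm, ht⟩ := h x
  simp only [← Pi.sub_def, eLpNorm_sub_comm (fun lam => PF lam x)] at ht
  have hmeas := tendstoInMeasure_of_tendsto_eLpNorm two_ne_zero
    (fun s => (memLp_partialSum hG F x s 2).1) hm.1 ht
  -- Convergence in L² gives convergence in measure, hence almost everywhere along a sequence of
  -- finite sets tending to `atTop`; where the series is summable, the two limits agree.
  obtain ⟨s, hs, hlim⟩ := hmeas.exists_seq_tendsto_ae'
  filter_upwards [hlim] with lam hl hsum
  exact tendsto_nhds_unique hl (hsum.hasSum.comp hs)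

theorem negLaplacian_edgeKernel (hG : G.IsTree) (h3 : G.IsRegularOfDegree 3) {lam : ℝ}
    (hl : lam ∈ interior specInterval) (x y : G.edgeSet) :
    negLaplacian G.lineGraph (fun x => edgeKernel G lam x y) x = lam * edgeKernel G lam x y := by
  have hk : (fun x => edgeKernel G lam x y) = fun x =>
      ((2 / 3 * radialPoly (G.lineGraph.dist y x) lam : ℝ) : ℂ) := funext fun x => by
    rw [edgeKernel_eq_radialPoly hG hl, SimpleGraph.dist_comm]
  have h := negLaplacian_radial hG h3 (fun n => ((2 / 3 * radialPoly n lam : ℝ) : ℂ)) y x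
  rw [hk, edgeKernel_eq_radialPoly hG hl, SimpleGraph.dist_comm (u := x)]
  cases hd : G.lineGraph.dist y x with
  | zero => rw [h.1 hd]; simp only [radialPoly]; push_cast; ring
  | succ n => rw [h.2 n hd]; simp only [radialPoly]; push_cast; ring

theorem negLaplacian_partialSum (hG : G.IsTree) (h3 : G.IsRegularOfDegree 3) {lam : ℝ}
    (hl : lam ∈ interior specInterval) (F : G.edgeSet → ℂ) (s : Finset G.edgeSet)
    (x : G.edgeSet) :
    negLaplacian G.lineGraph (fun x => ∑ y ∈ s, edgeKernel G lam x y * F y) x =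
      lam * ∑ y ∈ s, edgeKernel G lam x y * F y := by
  have h : (fun x => ∑ y ∈ s, edgeKernel G lam x y * F y) =
      ∑ y ∈ s, F y • fun x => edgeKernel G lam x y := by
    funext x
    rw [Finset.sum_apply]
    exact Finset.sum_congr rfl fun y _ => mul_comm _ _
  rw [h, map_sum, Finset.sum_apply, Finset.mul_sum]
  refine Finset.sum_congr rfl fun y _ => ?_
  rw [map_smul, Pi.smul_apply, negLaplacian_edgeKernel hG h3 hl, smul_eq_mul]
  ring

/-- The constant is 10 = 4 + 6: the degree of the edge graph plus a bound for |`lam`|. -/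
theorem norm_negLaplacian_sub_le (hG : G.IsTree) (h3 : G.IsRegularOfDegree 3) {lam : ℝ}
    (hl : lam ∈ interior specInterval) (u : G.edgeSet → ℂ) (x : G.edgeSet) :
    ‖negLaplacian G.lineGraph u x - lam * u x‖ ≤
      10 * ‖u x‖ + ∑ z ∈ G.lineGraph.neighborFinset x, ‖u z‖ := by
  rw [interior_specInterval] at hl
  have hlam : ‖(lam : ℂ)‖ ≤ 6 := by
    rw [Complex.norm_real, Real.norm_eq_abs, abs_le]
    constructor <;> linarith [hl.1, hl.2, two_mul_sqrt_two_lt]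
  have h1 : ‖(lam : ℂ) * u x‖ ≤ 6 * ‖u x‖ := by
    rw [norm_mul]
    exact mul_le_mul_of_nonneg_right hlam (norm_nonneg _)
  rw [negLaplacian_apply (isRegularOfDegree_lineGraph hG h3)]
  have h2 : ‖((4 : ℕ) : ℂ) * u x‖ = 4 * ‖u x‖ := by
    rw [norm_mul, Complex.norm_natCast]; norm_num
  have h3 := norm_sub_le (((4 : ℕ) : ℂ) * u x) (∑ z ∈ G.lineGraph.neighborFinset x, u z)
  have h4 := norm_sub_le (((4 : ℕ) : ℂ) * u x - ∑ z ∈ G.lineGraph.neighborFinset x, u z)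
    ((lam : ℂ) * u x)
  have h5 := norm_sum_le (G.lineGraph.neighborFinset x) u
  linarith

theorem IsKernelTransform.ae_negLaplacian_eq (hG : G.IsTree) (h3 : G.IsRegularOfDegree 3)
    {F : G.edgeSet → ℂ} {PF : ℝ → G.edgeSet → ℂ} (h : IsKernelTransform G F PF) :
    ∀ᵐ lam ∂specMeasure, negLaplacian G.lineGraph (PF lam) = (lam : ℂ) • PF lam := by
  have := countable_edgeSet hG h3
  suffices ∀ x : G.edgeSet, (fun lam => negLaplacian G.lineGraph (PF lam) x - lam * PF lam x)
      =ᵐ[specMeasure] 0 by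
    filter_upwards [ae_all_iff.2 this] with lam hl
    exact funext fun x => sub_eq_zero.1 (hl x)
  intro x
  set e : G.edgeSet → Finset G.edgeSet → ℝ → ℂ := fun x s lam =>
    PF lam x - ∑ y ∈ s, edgeKernel G lam x y * F y with he
  have hem : ∀ x s, MemLp (e x s) 2 specMeasure := fun x s =>
    (h x).1.sub (memLp_partialSum hG F x s 2)
  -- Since -Δ - `lam` annihilates every partial sum, it takes the same value on `PF lam` as on the
  -- remainder `e`, which is small in L² at `x` and at its finitely many neighbours.
  have hbound : ∀ s : Finset G.edgeSet,
      eLpNorm (fun lam => negLaplacian G.lineGraph (PF lam) x - lam * PF lam x) 2 specMeasure ≤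
        10 * eLpNorm (e x s) 2 specMeasure +
          ∑ z ∈ G.lineGraph.neighborFinset x, eLpNorm (e z s) 2 specMeasure := by
    intro s
    have h1 : eLpNorm (fun lam => negLaplacian G.lineGraph (PF lam) x - lam * PF lam x) 2
        specMeasure ≤ eLpNorm ((fun lam => 10 * ‖e x s lam‖) +
          ∑ z ∈ G.lineGraph.neighborFinset x, fun lam => ‖e z s lam‖) 2 specMeasure := by
      refine eLpNorm_mono_ae_real ?_
      filter_upwards [ae_mem_interior_specInterval] with lam hl
      have hb := norm_negLaplacian_sub_le hG h3 hl (fun x => e x s lam) x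
      have hsub : (fun x => e x s lam) = PF lam -
        fun x => ∑ y ∈ s, edgeKernel G lam x y * F y := rfl
      have heq : negLaplacian G.lineGraph (fun x => e x s lam) x - lam * e x s lam =
          negLaplacian G.lineGraph (PF lam) x - lam * PF lam x := by
        rw [hsub, map_sub, Pi.sub_apply, negLaplacian_partialSum hG h3 hl]
        simp only [he]
        ring
      rw [heq] at hb
      simpa only [Pi.add_apply, Finset.sum_apply] using hb
    have hn : ∀ z, AEStronglyMeasurable (fun lam => ‖e z s lam‖) specMeasure := fun z =>
      (hem z s).1.norm
    refine h1.trans ((eLpNorm_add_le ((hn x).const_mul 10)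
      (Finset.aestronglyMeasurable_sum _ fun z _ => hn z) one_le_two).trans ?_)
    refine add_le_add ?_ ((eLpNorm_sum_le (fun z _ => hn z) one_le_two).trans ?_)
    · have hc := eLpNorm_const_smul (10 : ℝ) (fun lam => ‖e x s lam‖) 2 specMeasure
      simp only [Pi.smul_def, smul_eq_mul, eLpNorm_norm] at hc
      rw [hc]
      refine le_of_eq ?_
      congr 1
      simp [enorm_eq_nnnorm]
    · exact Finset.sum_le_sum fun z _ => (eLpNorm_norm _).le
  have hlim : Tendsto (fun s : Finset G.edgeSet => 10 * eLpNorm (e x s) 2 specMeasure +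
      ∑ z ∈ G.lineGraph.neighborFinset x, eLpNorm (e z s) 2 specMeasure) atTop (𝓝 0) := by
    have h1 := ENNReal.Tendsto.const_mul (a := 10) (h x).2 (Or.inr (by norm_num))
    have h2 := tendsto_finsetSum (G.lineGraph.neighborFinset x) fun z _ => (h z).2
    simpa using h1.add h2
  have hzero : eLpNorm (fun lam => negLaplacian G.lineGraph (PF lam) x - lam * PF lam x) 2
      specMeasure = 0 := le_antisymm (ge_of_tendsto' hlim hbound) zero_le
  refine (eLpNorm_eq_zero_iff ?_ two_ne_zero).1 hzero
  refine AEStronglyMeasurable.sub ?_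
    (Complex.continuous_ofReal.aestronglyMeasurable.mul (h x).1.1)
  exact Finset.aestronglyMeasurable_fun_sum _ fun z _ => (h x).1.1.sub (h z).1.1

theorem IsKernelTransform.eq_add_integral (hG : G.IsTree) (h3 : G.IsRegularOfDegree 3)
    {F : L2 G.edgeSet} {PF : ℝ → G.edgeSet → ℂ} (h : IsKernelTransform G F PF)
    (x : G.edgeSet) : F x = projSix G F x + ∫ lam, PF lam x ∂specMeasure := by
  classical
  -- The factor 3/2 undoes the constant 2/3 in the pairing.
  have h1 := (h.hasSum_integral hG x).mul_left (3 / 2)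
  have h2 := (hasSum_ite_eq x (F x)).sub (hasSum_projSix hG h3 F x)
  have h4 := h1.unique (h2.congr_fun fun y => ?_)
  · linear_combination -h4
  · have hxy : y = x ↔ 0 = G.lineGraph.dist x y := by
      rw [eq_comm (a := 0), (lineGraph_connected hG x y).dist_eq_zero_iff, eq_comm]
    rw [inner_smul_right, inner_kernelLp, SimpleGraph.dist_self, projSixKernel, zero_add]
    by_cases hy : y = x
    · subst hy
      simp [sphereSize]
      ring
    · rw [if_neg hy, if_neg (mt hxy.2 hy)]
      push_cast
      ring

end Transform

end TreeSpectral

end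

theorem mainTheorem5 {V : Type*} (G : SimpleGraph V) [G.LocallyFinite]
    (hG : G.IsTree) (h3 : G.IsRegularOfDegree 3) :
    -- the measure is absolutely continuous, with an explicit density on the interval
    TreeSpectral.specMeasure =
      (volume.restrict TreeSpectral.specInterval).withDensity (fun lam =>
        ENNReal.ofReal (3 * √(-lam ^ 2 + 6 * lam - 1) / (2 * Real.pi * (lam * (6 - lam))))) ∧
    -- the kernel is an explicit function of the distance in the edge graph
    (∀ lam ∈ interior TreeSpectral.specInterval, ∀ x y : G.edgeSet,
      TreeSpectral.edgeKernel G lam x y =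
        (6 - (lam : ℂ))⁻¹ *
          TreeSpectral.psi (TreeSpectral.critPoint lam) (G.lineGraph.dist x y)) ∧
    ∀ F : TreeSpectral.L2 G.edgeSet,
      -- the kernel of the projection onto the 6-eigenspace
      (∀ x : G.edgeSet,
        HasSum (fun y : G.edgeSet => (1 / 3 : ℂ) * (-1 / 2) ^ (G.lineGraph.dist x y) * F y)
          (TreeSpectral.projSix G F x)) ∧
      -- the series defining the components converges
      (∃ PF : ℝ → G.edgeSet → ℂ, TreeSpectral.IsKernelTransform G F PF) ∧
      ∀ PF : ℝ → G.edgeSet → ℂ, TreeSpectral.IsKernelTransform G F PF →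
        -- its sum is the pointwise sum wherever that exists
        (∀ᵐ lam ∂TreeSpectral.specMeasure, ∀ x : G.edgeSet,
          Summable (fun y : G.edgeSet => TreeSpectral.edgeKernel G lam x y * F y) →
            PF lam x = ∑' y : G.edgeSet, TreeSpectral.edgeKernel G lam x y * F y) ∧
        -- the components are eigenfunctions
        (∀ᵐ lam ∂TreeSpectral.specMeasure,
          TreeSpectral.negLaplacian G.lineGraph (PF lam) = (lam : ℂ) • PF lam) ∧
        -- the spectral resolution
        ∀ x : G.edgeSet,
          Integrable (fun lam => PF lam x) TreeSpectral.specMeasure ∧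
            F x = TreeSpectral.projSix G F x + ∫ lam, PF lam x ∂TreeSpectral.specMeasure :=
  ⟨TreeSpectral.specMeasure_eq_withDensity,
    fun lam _ x y => TreeSpectral.edgeKernel_eq_psi hG lam x y,
    fun F => ⟨TreeSpectral.hasSum_projSix hG h3 F, TreeSpectral.exists_isKernelTransform hG h3 F,
      fun _ hPF => ⟨hPF.ae_eq_tsum hG h3, hPF.ae_negLaplacian_eq hG h3,
        fun x => ⟨hPF.integrable x, hPF.eq_add_integral hG h3 x⟩⟩⟩⟩
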